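/- **Conventions.** For an ordered field $K$ let $\mathbf P^1(K)=K\cup\{\infty\}$ carry the cyclic order induced by the order of $K$ and the action of $\mathrm{PSL}_2(K)$ by Möbius transformations. A tuple in $\mathbf P^1(K)$ is *positive* if it or its reverse is cyclically ordered. An element of $K$ is infinitesimal if its absolute value is smaller than $1/n$ for all integers $n\ge 1$. An *infinitesimal rotation* is an element $g\in \mathrm{PSL}_2(K)$ with $|\mathrm{Tr}\,g|<2$ and $2-|\mathrm{Tr}\, g|$ infinitesimal. A $K$-line $l$ is given by two distinct endpoints $x,y\in\mathbf P^1(K)$; the reflection about $l$ is the class in $\mathrm{PGL}_2(K)$ of a matrix with eigenlines $x,y$ and eigenvalues $1,-1$; the product of two reflections lies in $\mathrm{PSL}_2(K)$. The cross-ratio is normalised by $\mathrm{CR}(0,1,t,\infty)=t$. *Three-holed sphere groups.* Let $s_1,s_2,s_3$ be the reflections about three lines of the real hyperbolic plane that are pairwise disjoint (common endpoints at infinity are allowed) and none of which separates the other two. Let $\Gamma_{0,3}\subset\mathrm{PSL}_2(\mathbb R)$ be the group generated by $a=s_1s_2$ and $b=s_2s_3$, and put $c=(ab)^{-1}$. Then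 $\Gamma_{0,3}\backslash\mathbf H_{\mathbb R}$ is a three-holed sphere, with peripheral elements $a,b,c$, each of which is hyperbolic or parabolic. *Representations.* Let $\Gamma=\Gamma_{0,3}$, let $\Lambda(\Gamma)\subset\mathbf P^1(\mathbb R)$ be its limit set and $\Lambda_p$ the set of fixed points of its parabolic elements. A representation $\rho:\Gamma\to\mathrm{PSL}_2(K)$ is *positive* if there are a non-empty $\Gamma$-invariant $D\subset\Lambda(\Gamma)$ and a $\rho$-equivariant map $\xi:D\to\mathbf P^1(K)$ that maps cyclically ordered tuples to positive tuples. A *framing* of $\rho$ is a $\rho$-equivariant map $\Lambda_p\to\mathbf P^1(K)$, and $\rho$ is *(positively) frameable* if it has a framing that maps cyclically ordered tuples to positive tuples. **Statement.** Let $\mathbb F$ be a real closed field. (1) Let $\Gamma_{0,3}$ be as above and let $\rho:\Gamma_{0,3}\to\mathrm{PSL}_2(\mathbb F)$ be a representation such that $\rho(a)$ is hyperbolic, with attracting fixed point $\rho(a)^+$. Assume that there are pairwise disjoint sets $U_1,U_2,V_1,V_2\subset\mathbf P^1(\mathbb F)$ with $\rho(a)^+\in U_2$ such that $\rho(a)(U_1^c)\subset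 U_2$, $\rho(a)^{-1}(U_2^c)\subset U_1$, $\rho(b)(V_1^c)\subset V_2$, $\rho(b)^{-1}(V_2^c)\subset V_1$, and such that $(u_1,u_2,v_1,v_2)$ is cyclically ordered for all $u_i\in U_i$, $v_i\in V_i$. Then $\rho$ is positive. (2) Assume that $\mathbb F$ is non-Archimedean. Let $l_1,l_2,l_3$ be $\mathbb F$-lines with endpoints $x_i,y_i$ such that $(x_1,y_3,y_1,x_3,y_2,x_2)$ is cyclically ordered and $\mathrm{CR}(x_1,y_1,y_3,x_3)-1$ is negative and infinitesimal, and let $\sigma_i$ be the reflection about $l_i$. Then for every $\Gamma_{0,3}$ as above there is a representation $\rho:\Gamma_{0,3}\to\mathrm{PSL}_2(\mathbb F)$ with $\rho(a)=\sigma_1\sigma_2$ and $\rho(b)=\sigma_2\sigma_3$. It is positive, and $\rho(c)$ is an infinitesimal rotation without fixed point in $\mathbf P^1(\mathbb F)$. If $c$ is parabolic, then $\rho$ has no framing at all; in particular it is not frameable. (3) If $\mathbb F$ is non-Archimedean, lines $l_1,l_2,l_3$ as in (2) exist over $\mathbb F$. Moreover there is a group $\Gamma_{0,3}$ as above with limit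 set $\mathbf P^1(\mathbb R)$ (i.e. of the first kind) for which $a$, $b$ and $c$ are all parabolic. Hence, for this $\Gamma_{0,3}$, there is a representation into $\mathrm{PSL}_2(\mathbb F)$ that is positive but not frameable. -/

import Mathlib

open OnePoint Matrix
open scoped MatrixGroups

noncomputable section

namespace PosRep

/-! The projective line `P¹(K)` is `OnePoint K`, that is `K ∪ {∞}`. -/

section ProjectiveLine

variable {K : Type*}

/-- The group `PSL(2, K)` acts on `P¹(K)` by Möbius transformations: the class of a matrix acts as
the matrix does. -/
def pslHom (K : Type*) [Field K] [DecidableEq K] : PSL(2, K) →* Equiv.Perm (OnePoint K) :=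
  QuotientGroup.lift _
    ((MulAction.toPermHom (GL (Fin 2) K) (OnePoint K)).comp
      Matrix.SpecialLinearGroup.toGL) (by
    intro A hA
    obtain ⟨r, -, hr⟩ := Matrix.SpecialLinearGroup.mem_center_iff.mp hA
    have h00 : A.1 0 0 = r := by rw [← hr]; simp
    have h01 : A.1 0 1 = 0 := by rw [← hr]; simp
    have h10 : A.1 1 0 = 0 := by rw [← hr]; simp
    have h11 : A.1 1 1 = r := by rw [← hr]; simp
    have hdet : r * r = 1 := by
      have := A.2
      rw [Matrix.det_fin_two, h00, h01, h10, h11] at this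
      simpa using this
    have hr0 : r ≠ 0 := by rintro rfl; simp at hdet
    ext p
    induction p using OnePoint.rec with
    | infty => simp [OnePoint.smul_infty_eq_ite, h10]
    | coe k =>
      simp [OnePoint.smul_some_eq_ite, h00, h01, h10, h11, hr0])

instance pslAction [Field K] [DecidableEq K] : MulAction PSL(2, K) (OnePoint K) :=
  MulAction.compHom (OnePoint K) (pslHom K)

theorem mk_smul [Field K] [DecidableEq K] (A : SL(2, K)) (p : OnePoint K) :
    ((A : PSL(2, K)) • p) = Matrix.SpecialLinearGroup.toGL A • p := rfl

/-- Homogeneous coordinates: `[z : 1]` for `z ∈ K` and `[1 : 0]` for `∞`. -/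
def homog [Zero K] [One K] : OnePoint K → (Fin 2 → K)
  | OnePoint.some z => ![z, 1]
  | ∞ => ![1, 0]

/-- The determinant of the homogeneous coordinates of two points. -/
def det2 [Field K] (x y : OnePoint K) : K :=
  homog x 0 * homog y 1 - homog x 1 * homog y 0

theorem det2_ne_zero [Field K] {x y : OnePoint K} (h : x ≠ y) : det2 x y ≠ 0 := by
  induction x using OnePoint.rec with
  | infty =>
    induction y using OnePoint.rec with
    | infty => exact absurd rfl h
    | coe b => simp [det2, homog]
  | coe a =>
    induction y using OnePoint.rec with
    | infty => simp [det2, homog]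
    | coe b =>
      have : a ≠ b := fun e => h (by rw [e])
      simpa [det2, homog, sub_eq_zero] using this

/-- The cross-ratio, normalised by `CR(0, 1, t, ∞) = t`. It is only used at four distinct points. -/
def crossRatio [Field K] (x y z w : OnePoint K) : K :=
  (det2 x z * det2 y w) / (det2 x y * det2 z w)

/-- The order of `K`, extended to `P¹(K)` with `∞` as largest element. -/
def ltTop [LT K] : OnePoint K → OnePoint K → Prop
  | OnePoint.some a, OnePoint.some b => a < b
  | OnePoint.some _, ∞ => True
  | ∞, _ => False

/-- The cyclic order on `P¹(K)` determined by the order of `K`. -/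
def Cyc [LT K] (x y z : OnePoint K) : Prop :=
  (ltTop x y ∧ ltTop y z) ∨ (ltTop y z ∧ ltTop z x) ∨ (ltTop z x ∧ ltTop x y)

/-- Cyclically ordered `n`-tuples. -/
def CycTuple [LT K] {n : ℕ} (x : Fin n → OnePoint K) : Prop :=
  ∀ i j k : Fin n, i < j → j < k → Cyc (x i) (x j) (x k)

/-- Positive `n`-tuples in the flag variety `P¹(K)` of `PSL(2, K)`: those that are cyclically
ordered or reverse cyclically ordered. -/
def PositiveTuple [LT K] {n : ℕ} (x : Fin n → OnePoint K) : Prop :=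
  CycTuple x ∨ CycTuple (fun i => x i.rev)

/-- The open interval `(x, y)` of the cyclic order. -/
def arc [LT K] (x y : OnePoint K) : Set (OnePoint K) := {w | Cyc x w y}

/-- A line of the upper half plane over `K`, given by its two endpoints. -/
structure Line (K : Type*) where
  x : OnePoint K
  y : OnePoint K
  ne : x ≠ y

/-- The reflection about a line, as a matrix of determinant `-1`; the endpoints of the line are
the eigenlines, for the eigenvalues `1` and `-1`. -/
def Line.refl [Field K] (l : Line K) : Matrix (Fin 2) (Fin 2) K :=
  (det2 l.x l.y)⁻¹ •
    !![homog l.x 0 * homog l.y 1 + homog l.x 1 * homog l.y 0, -(2 * homog l.x 0 * homog l.y 0);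
       2 * homog l.x 1 * homog l.y 1, -(homog l.x 0 * homog l.y 1 + homog l.x 1 * homog l.y 0)]

theorem Line.refl_mulVec_x [Field K] (l : Line K) : l.refl *ᵥ homog l.x = homog l.x := by
  have h := det2_ne_zero l.ne
  ext i
  fin_cases i <;>
    simp [Line.refl, -Matrix.cons_mulVec, Matrix.mulVec, dotProduct, Fin.sum_univ_two] <;>
    field_simp <;> simp [det2] <;> ring

theorem Line.refl_mulVec_y [Field K] (l : Line K) : l.refl *ᵥ homog l.y = -homog l.y := by
  have h := det2_ne_zero l.ne
  ext i
  fin_cases i <;>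
    simp [Line.refl, -Matrix.cons_mulVec, Matrix.mulVec, dotProduct, Fin.sum_univ_two] <;>
    field_simp <;> simp [det2] <;> ring

theorem Line.det_refl [Field K] (l : Line K) : l.refl.det = -1 := by
  have h := det2_ne_zero l.ne
  simp only [Line.refl, Matrix.det_smul, Matrix.det_fin_two_of, Fintype.card_fin]
  field_simp
  simp only [det2]
  ring

/-- The product of the reflections about two lines, as an element of `PSL(2, K)`. -/
def Line.reflMul [Field K] (l l' : Line K) : PSL(2, K) :=
  QuotientGroup.mk (⟨l.refl * l'.refl, by
    rw [Matrix.det_mul, l.det_refl, l'.det_refl]; norm_num⟩ : SL(2, K))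

/-- `p` is the attracting fixed point of the hyperbolic element `g`: it is the eigenline of a lift
of `g` for an eigenvalue of absolute value larger than one. -/
def IsAttractingFixedPoint [Field K] [LinearOrder K] (g : PSL(2, K)) (p : OnePoint K) : Prop :=
  ∃ (A : SL(2, K)) (t : K), (A : PSL(2, K)) = g ∧ 1 < |t| ∧ A.1 *ᵥ homog p = t • homog p

/-- Infinitesimal elements of an ordered field. -/
def IsInfinitesimal [Field K] [LinearOrder K] (t : K) : Prop :=
  ∀ n : ℕ, (n : K) * |t| < 1

/-- Infinitesimal rotations: elliptic elements (`|tr| < 2`) for which `2 - |tr|` is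
infinitesimal. -/
def IsInfinitesimalRotation [Field K] [LinearOrder K] (g : PSL(2, K)) : Prop :=
  ∃ A : SL(2, K), (A : PSL(2, K)) = g ∧ |A.1.trace| < 2 ∧ IsInfinitesimal (2 - |A.1.trace|)

end ProjectiveLine

section Fuchsian

/-- The limit set of `Γ ≤ PSL(2, ℝ)`: the points of the circle `P¹(ℝ)` at which the orbit of the
base point `i` of the upper half plane accumulates, in the Riemann sphere. -/
def limitSet (Γ : Subgroup PSL(2, ℝ)) : Set (OnePoint ℝ) :=
  {x | x.map (fun t : ℝ => (t : ℂ)) ∈ closure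
    {z : OnePoint ℂ | ∃ A : SL(2, ℝ), (A : PSL(2, ℝ)) ∈ Γ ∧
      z = (((A • UpperHalfPlane.I : UpperHalfPlane) : ℂ) : OnePoint ℂ)}}

/-- Parabolic elements of `PSL(2, ℝ)`: those with exactly one fixed point on the circle. -/
def IsParabolicElement (g : PSL(2, ℝ)) : Prop := ∃! x : OnePoint ℝ, g • x = x

/-- The set of fixed points of parabolic elements of `Γ`. -/
def parabolicPoints (Γ : Subgroup PSL(2, ℝ)) : Set (OnePoint ℝ) :=
  {x | ∃ g ∈ Γ, IsParabolicElement g ∧ g • x = x}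

variable {F : Type*} [Field F] [LinearOrder F] {Γ : Subgroup PSL(2, ℝ)}

/-- `ξ` is `ρ`-equivariant on the subset `D` of the circle. -/
def EquivariantOn (ρ : Γ →* PSL(2, F)) (ξ : OnePoint ℝ → OnePoint F) (D : Set (OnePoint ℝ)) :
    Prop :=
  ∀ γ : Γ, ∀ x ∈ D, ξ ((γ : PSL(2, ℝ)) • x) = ρ γ • ξ x

/-- `ξ` is positive on `D`: it maps cyclically ordered tuples in `D` to positive tuples. -/
def PositiveOn (ξ : OnePoint ℝ → OnePoint F) (D : Set (OnePoint ℝ)) : Prop :=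
  ∀ (n : ℕ) (x : Fin n → OnePoint ℝ), (∀ i, x i ∈ D) → CycTuple x → PositiveTuple (ξ ∘ x)

/-- Positive representations: there is a positive equivariant map on some non-empty invariant
subset of the limit set. -/
def IsPositive (ρ : Γ →* PSL(2, F)) : Prop :=
  ∃ D : Set (OnePoint ℝ), D ⊆ limitSet Γ ∧ D.Nonempty ∧
    (∀ γ ∈ Γ, ∀ x ∈ D, γ • x ∈ D) ∧
    ∃ ξ : OnePoint ℝ → OnePoint F, EquivariantOn ρ ξ D ∧ PositiveOn ξ D

/-- Framings: equivariant maps on the set of parabolic fixed points. -/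
def IsFraming (ρ : Γ →* PSL(2, F)) (ξ : OnePoint ℝ → OnePoint F) : Prop :=
  EquivariantOn ρ ξ (parabolicPoints Γ)

/-- Positively frameable representations. -/
def IsFrameable (ρ : Γ →* PSL(2, F)) : Prop :=
  ∃ ξ : OnePoint ℝ → OnePoint F, IsFraming ρ ξ ∧ PositiveOn ξ (parabolicPoints Γ)

end Fuchsian

section ThreeHoledSphere

/-- Three lines of the hyperbolic plane that are pairwise disjoint (common endpoints on the circle
are allowed) and none of which separates the other two: the open intervals `(xᵢ, yᵢ)` of the
circle are pairwise disjoint. Two copies of the region that the lines bound, glued along the lines,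
form a hyperbolic three-holed sphere; its ends are cusps where two lines share an endpoint and
funnels otherwise. -/
def IsHyperbolicTriple (l : Fin 3 → Line ℝ) : Prop :=
  Pairwise fun i j => Disjoint (arc (l i).x (l i).y) (arc (l j).x (l j).y)

/-- The three-holed sphere group: the subgroup of `PSL(2, ℝ)` generated by `a = s₁ s₂` and
`b = s₂ s₃`, where the `sᵢ` are the reflections about the three lines. -/
def threeHoledSphereGroup (l : Fin 3 → Line ℝ) : Subgroup PSL(2, ℝ) :=
  Subgroup.closure {(l 0).reflMul (l 1), (l 1).reflMul (l 2)}

def genA (l : Fin 3 → Line ℝ) : threeHoledSphereGroup l :=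
  ⟨(l 0).reflMul (l 1), Subgroup.subset_closure (by simp)⟩

def genB (l : Fin 3 → Line ℝ) : threeHoledSphereGroup l :=
  ⟨(l 1).reflMul (l 2), Subgroup.subset_closure (by simp)⟩

/-- The third peripheral element `c`, with `a b c = 1`. -/
def genC (l : Fin 3 → Line ℝ) : threeHoledSphereGroup l := (genB l)⁻¹ * (genA l)⁻¹

/-- Three lines over an ordered field of which the first and the third cross at an infinitesimal
angle: the endpoints come in the cyclic order `x₁, y₃, y₁, x₃, y₂, x₂`, and
`CR(x₁, y₁, y₃, x₃) - 1` is negative and infinitesimal. -/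
def IsCrossingTriple {F : Type*} [Field F] [LinearOrder F] (m : Fin 3 → Line F) : Prop :=
  CycTuple ![(m 0).x, (m 2).y, (m 0).y, (m 2).x, (m 1).y, (m 1).x] ∧
  crossRatio (m 0).x (m 0).y (m 2).y (m 2).x - 1 < 0 ∧
  IsInfinitesimal (crossRatio (m 0).x (m 0).y (m 2).y (m 2).x - 1)

end ThreeHoledSphere

end PosRep

end

open PosRep

/-!
Both parts of the theorem about positivity follow from one fact about ping-pong. Suppose that `a`
and `b` play ping-pong on a cyclically ordered set, with sets for the letters `a⁻¹, a, b⁻¹, b`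
that come in this cyclic order, and that `a` fixes a point `p` of its own set. The points of the
orbit of `p` are spelled by reduced words that do not end in a power of `a`, and stripping off
common initial letters shows that the cyclic order of three such points can be read off from the
words (`PingPong.order_words`). Hence two systems of this kind for the same group have orbits with
the same cyclic order. This is made precise by applying the statement to the product of the two
spaces, with the relation that holds if both cyclic orders do (`PingPong.prod`). One of the
systems is always the action of the three-holed sphere group on the circle, with a fixed point of
`a` as base point; the orbit lies in the limit set, and sending `γ p` to `ρ(γ) q` is the positive
equivariant map (`isPositive_of_pingPong`). The positivity criterion is immediate from this.

For groups generated by products of two reflections, the ping-pong sets come from sets of points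
outside of which the reflections map into prescribed sets (`MirrorSystem`). On the circle these
are the half-open intervals between the endpoints of the lines; the two choices of half-open
intervals are exchanged by the reflections, so that they remain disjoint if lines have common
endpoints. This also shows that a three-holed sphere group is free on `a` and `b`, so that
representations can be prescribed on `a` and `b`.

For a crossing triple of lines over a non-Archimedean field the first and the third line cross,
and no choice of intervals works. After a normalization, these two lines end at `1` and at a point
`t < 1` infinitesimally close to `1`, and the set of all points infinitesimally close to `1` is
invariant under both reflections. It is therefore possible to treat it as a common endpoint of the
two lines: on one side of the configuration it is added to the interval of the first line, and on
the other side to the interval of the third line (`mirrorSystem_of_normalized`). The image of `c`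
is the product of the reflections about the crossing lines, so that its trace is determined by
their cross-ratio and it is an infinitesimal rotation without fixed points. If `c` is parabolic,
then a framing would have to map the fixed point of `c` to a fixed point of the image of `c`.

The group of the ideal triangle with vertices `0, 1, ∞` is of the first kind: by the Euclidean
algorithm with even quotients the orbit of the parabolic fixed point `∞` contains all fractions
with odd numerator and even denominator, and these are dense.
-/

noncomputable section

namespace PosRep

/-! ### The cyclic order of the projective line -/

section CyclicOrder

variable {K : Type*} [Field K]

theorem homog_coe (a : K) : homog (a : OnePoint K) = ![a, 1] := rfl

theorem homog_infty : homog (∞ : OnePoint K) = ![1, 0] := rfl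

theorem det2_self (x : OnePoint K) : det2 x x = 0 := by simp [det2]; ring

theorem det2_swap (x y : OnePoint K) : det2 y x = -det2 x y := by simp [det2]; ring

theorem det2_eq_zero_iff {x y : OnePoint K} : det2 x y = 0 ↔ x = y :=
  ⟨fun h => by_contra fun hn => det2_ne_zero hn h, fun h => h ▸ det2_self x⟩

theorem eq_of_homog_eq_smul {x y : OnePoint K} {c : K} (h : homog x = c • homog y) : x = y := by
  rw [← det2_eq_zero_iff, det2, h]
  simp
  ring

variable [LinearOrder K] [IsStrictOrderedRing K]

/-- The cyclic order is an algebraic notion: the sign of the product of the three `2 × 2`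
determinants of homogeneous coordinates. -/
theorem cyc_iff (x y z : OnePoint K) : Cyc x y z ↔ 0 < det2 x y * det2 y z * det2 z x := by
  induction x using OnePoint.rec with
  | infty =>
    induction y using OnePoint.rec with
    | infty => simp [Cyc, ltTop, det2, homog]
    | coe b =>
      induction z using OnePoint.rec with
      | infty => simp [Cyc, ltTop, det2, homog]
      | coe c => simp [Cyc, ltTop, det2, homog]
  | coe a =>
    induction y using OnePoint.rec with
    | infty =>
      induction z using OnePoint.rec with
      | infty => simp [Cyc, ltTop, det2, homog]
      | coe c => simp [Cyc, ltTop, det2, homog]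
    | coe b =>
      induction z using OnePoint.rec with
      | infty => simp [Cyc, ltTop, det2, homog]
      | coe c =>
        simp only [Cyc, ltTop, det2, homog, Matrix.cons_val_zero, Matrix.cons_val_one, mul_one,
          one_mul]
        constructor
        · rintro (⟨h1, h2⟩ | ⟨h1, h2⟩ | ⟨h1, h2⟩)
          · exact mul_pos (mul_pos_of_neg_of_neg (by linarith) (by linarith)) (by linarith)
          · rw [mul_assoc]
            exact mul_pos (by linarith) (mul_pos_of_neg_of_neg (by linarith) (by linarith))
          · rw [mul_right_comm]
            exact mul_pos (mul_pos_of_neg_of_neg (by linarith) (by linarith)) (by linarith)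
        · intro h
          rcases lt_trichotomy a b with h1 | h1 | h1
          · rcases lt_trichotomy b c with h2 | h2 | h2
            · exact Or.inl ⟨h1, h2⟩
            · subst h2; simp at h
            · have : 0 < (a - b) * (b - c) * -(a - c) := by linarith [h]
              have h3 : (a - b) * (b - c) < 0 := mul_neg_of_neg_of_pos (by linarith) (by linarith)
              exact Or.inr (Or.inr ⟨by
                by_contra h4
                nlinarith, h1⟩)
          · subst h1; simp at h
          · rcases lt_trichotomy b c with h2 | h2 | h2
            · have h3 : (a - b) * (b - c) < 0 := mul_neg_of_pos_of_neg (by linarith) (by linarith)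
              exact Or.inr (Or.inl ⟨h2, by
                by_contra h4
                nlinarith⟩)
            · subst h2; simp at h
            · have h3 : 0 < (a - b) * (b - c) := mul_pos (by linarith) (by linarith)
              nlinarith

theorem Cyc.rot {x y z : OnePoint K} (h : Cyc x y z) : Cyc y z x := by
  rw [cyc_iff] at h ⊢
  linarith

theorem Cyc.ne {x y z : OnePoint K} (h : Cyc x y z) : x ≠ y := by
  rintro rfl
  rw [cyc_iff, det2_self] at h
  simp at h

theorem Cyc.ne' {x y z : OnePoint K} (h : Cyc x y z) : y ≠ z := h.rot.ne

theorem Cyc.ne'' {x y z : OnePoint K} (h : Cyc x y z) : x ≠ z := h.rot.rot.ne.symm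

theorem Cyc.asymm {x y z : OnePoint K} (h : Cyc x y z) : ¬ Cyc z y x := by
  rw [cyc_iff] at h ⊢
  rw [det2_swap x y, det2_swap y z, det2_swap z x]
  linarith

theorem cyc_total {x y z : OnePoint K} (hxy : x ≠ y) (hyz : y ≠ z) (hzx : z ≠ x) :
    Cyc x y z ∨ Cyc z y x := by
  rw [cyc_iff, cyc_iff, det2_swap x y, det2_swap y z, det2_swap z x]
  rcases lt_or_gt_of_ne (mul_ne_zero (mul_ne_zero (det2_ne_zero hxy) (det2_ne_zero hyz))
    (det2_ne_zero hzx)) with h | h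
  · right; linarith
  · left; exact h

theorem Cyc.trans {x y z w : OnePoint K} (h : Cyc x y z) (h' : Cyc x z w) : Cyc x y w := by
  have key : det2 x y * det2 z w - det2 x z * det2 y w + det2 x w * det2 y z = 0 := by
    simp only [det2]; ring
  rw [cyc_iff] at *
  rw [det2_swap x z] at h
  rw [det2_swap x w] at h' ⊢
  generalize det2 x y = a at *
  generalize det2 x z = b at *
  generalize det2 x w = c at *
  generalize det2 y z = d at *
  generalize det2 z w = e at *
  generalize det2 y w = f at *
  have hb : 0 < b ^ 2 := by
    have : b ≠ 0 := by rintro rfl; simp at h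
    positivity
  have h1 : 0 < (a ^ 2) * (b * e * -c) := by
    have : a ≠ 0 := by rintro rfl; simp at h
    positivity
  have h2 : 0 < (c ^ 2) * (a * d * -b) := by
    have : c ≠ 0 := by rintro rfl; simp at h'
    positivity
  have h3 : b ^ 2 * (a * f * -c) = (a ^ 2) * (b * e * -c) + (c ^ 2) * (a * d * -b) := by
    linear_combination (a * b * c) * key
  exact pos_of_mul_pos_right (h3 ▸ add_pos h1 h2) hb.le

end CyclicOrder

/-! ### Möbius transformations and reflections -/

section Moebius

variable {K : Type*} [Field K] [DecidableEq K]

theorem exists_mulVec_homog (g : GL (Fin 2) K) (x : OnePoint K) :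
    ∃ c : K, c ≠ 0 ∧ g.1 *ᵥ homog x = c • homog (g • x) := by
  induction x using OnePoint.rec with
  | infty =>
    rw [smul_infty_eq_ite]
    split_ifs with h
    · have h' : g.1 0 0 ≠ 0 := by
        intro h0
        apply g.det_ne_zero
        rw [Matrix.det_fin_two, h0, h]; simp
      refine ⟨g.1 0 0, h', ?_⟩
      ext i; fin_cases i
      · simp [homog, Matrix.mulVec, dotProduct, Fin.sum_univ_two]
      · simpa [homog, Matrix.mulVec, dotProduct, Fin.sum_univ_two] using h
    · refine ⟨g.1 1 0, h, ?_⟩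
      ext i; fin_cases i
      · simp [homog, Matrix.mulVec, dotProduct, Fin.sum_univ_two]
        field_simp
      · simp [homog, Matrix.mulVec, dotProduct, Fin.sum_univ_two]
  | coe a =>
    rw [smul_some_eq_ite]
    split_ifs with h
    · refine ⟨g.1 0 0 * a + g.1 0 1, ?_, ?_⟩
      · intro h0
        apply g.det_ne_zero
        rw [Matrix.det_fin_two]
        by_cases h2 : g.1 1 0 = 0
        · have h3 : g.1 1 1 = 0 := by simpa [h2] using h
          rw [h2, h3]; simp
        · have h4 : g.1 1 0 * (g.1 0 0 * g.1 1 1 - g.1 0 1 * g.1 1 0) = 0 := by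
            linear_combination g.1 1 0 * g.1 0 0 * h - g.1 1 0 ^ 2 * h0
          exact (mul_eq_zero.mp h4).resolve_left h2
      · ext i; fin_cases i
        · simp [homog, Matrix.mulVec, dotProduct, Fin.sum_univ_two]
        · simpa [homog, Matrix.mulVec, dotProduct, Fin.sum_univ_two] using h
    · refine ⟨g.1 1 0 * a + g.1 1 1, h, ?_⟩
      ext i; fin_cases i
      · simp [homog, Matrix.mulVec, dotProduct, Fin.sum_univ_two]
        have := div_mul_cancel₀ (g.1 0 0 * a + g.1 0 1) h
        linear_combination -this
      · simp [homog, Matrix.mulVec, dotProduct, Fin.sum_univ_two]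

theorem smul_eq_of_mulVec_eq {g : GL (Fin 2) K} {x y : OnePoint K} {c : K}
    (h : g.1 *ᵥ homog x = c • homog y) : g • x = y := by
  obtain ⟨d, hd, h'⟩ := exists_mulVec_homog g x
  refine eq_of_homog_eq_smul (c := d⁻¹ * c) ?_
  rw [mul_smul, ← h, h', smul_smul, inv_mul_cancel₀ hd, one_smul]

theorem det2_smul (g : GL (Fin 2) K) (x y : OnePoint K) {c d : K}
    (hc : g.1 *ᵥ homog x = c • homog (g • x)) (hd : g.1 *ᵥ homog y = d • homog (g • y)) :
    c * d * det2 (g • x) (g • y) = g.1.det * det2 x y := by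
  have c0 := congrFun hc 0
  have c1 := congrFun hc 1
  have d0 := congrFun hd 0
  have d1 := congrFun hd 1
  simp only [Matrix.mulVec, dotProduct, Fin.sum_univ_two, Pi.smul_apply, smul_eq_mul] at c0 c1 d0 d1
  have : c * d * det2 (g • x) (g • y) =
      (c * homog (g • x) 0) * (d * homog (g • y) 1) -
        (c * homog (g • x) 1) * (d * homog (g • y) 0) := by
    simp only [det2]; ring
  rw [this, ← c0, ← c1, ← d0, ← d1, Matrix.det_fin_two, det2]
  ring

end Moebius

section MoebiusOrder

variable {K : Type*} [Field K] [LinearOrder K] [IsStrictOrderedRing K]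

theorem exists_det2_triple_smul (g : GL (Fin 2) K) (x y z : OnePoint K) :
    ∃ c : K, 0 < c ∧ c * (det2 (g • x) (g • y) * det2 (g • y) (g • z) * det2 (g • z) (g • x)) =
      g.1.det * (det2 x y * det2 y z * det2 z x) := by
  obtain ⟨c, hc, h1⟩ := exists_mulVec_homog g x
  obtain ⟨d, hd, h2⟩ := exists_mulVec_homog g y
  obtain ⟨e, he, h3⟩ := exists_mulVec_homog g z
  have hg : g.1.det ≠ 0 := g.det_ne_zero
  refine ⟨(c * d * e) ^ 2 / g.1.det ^ 2, by positivity, ?_⟩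
  have e1 := det2_smul g x y h1 h2
  have e2 := det2_smul g y z h2 h3
  have e3 := det2_smul g z x h3 h1
  field_simp
  calc _ = (c * d * det2 (g • x) (g • y)) * (d * e * det2 (g • y) (g • z)) *
        (e * c * det2 (g • z) (g • x)) := by ring
    _ = _ := by rw [e1, e2, e3]; ring

theorem cyc_smul_iff {g : GL (Fin 2) K} (hg : 0 < g.1.det) (x y z : OnePoint K) :
    Cyc (g • x) (g • y) (g • z) ↔ Cyc x y z := by
  obtain ⟨c, hc, h⟩ := exists_det2_triple_smul g x y z
  rw [cyc_iff, cyc_iff, ← mul_pos_iff_of_pos_left hc, h, mul_pos_iff_of_pos_left hg]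

theorem cyc_smul_iff_of_det_neg {g : GL (Fin 2) K} (hg : g.1.det < 0) (x y z : OnePoint K) :
    Cyc (g • x) (g • y) (g • z) ↔ Cyc z y x := by
  obtain ⟨c, hc, h⟩ := exists_det2_triple_smul g x y z
  have : g.1.det * (det2 x y * det2 y z * det2 z x) =
      -g.1.det * (det2 z y * det2 y x * det2 x z) := by
    rw [det2_swap x y, det2_swap y z, det2_swap z x]; ring
  rw [cyc_iff, cyc_iff, ← mul_pos_iff_of_pos_left hc, h, this,
    mul_pos_iff_of_pos_left (by linarith)]

theorem cyc_psl_smul_iff (g : PSL(2, K)) (x y z : OnePoint K) :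
    Cyc (g • x) (g • y) (g • z) ↔ Cyc x y z := by
  induction g using QuotientGroup.induction_on with
  | H A =>
    rw [mk_smul, mk_smul, mk_smul]
    exact cyc_smul_iff (by
      rw [show (Matrix.SpecialLinearGroup.toGL A).1 = A.1 from rfl, A.2]; exact one_pos) x y z

end MoebiusOrder

section Reflections

variable {K : Type*} [Field K]

/-- The reflection about a line, as an element of `GL(2, K)`. -/
def Line.reflGL (l : Line K) : GL (Fin 2) K :=
  Matrix.GeneralLinearGroup.mkOfDetNeZero l.refl (by rw [l.det_refl]; norm_num)

theorem Line.coe_reflGL (l : Line K) : l.reflGL.1 = l.refl := rfl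

theorem Line.refl_mul_self (l : Line K) : l.refl * l.refl = 1 := by
  have h := det2_ne_zero l.ne
  simp only [Line.refl, Matrix.smul_mul, Matrix.mul_smul, Matrix.mul_fin_two, Matrix.one_fin_two,
    smul_smul]
  ext i j
  fin_cases i <;> fin_cases j <;> simp <;> field_simp <;>
    first | (simp only [det2]; ring1) | (right; ring1)

theorem Line.reflGL_mul_self (l : Line K) : l.reflGL * l.reflGL = 1 :=
  Units.ext l.refl_mul_self

/-- The lift to `SL(2, K)` of the product of the reflections about two lines. -/
def Line.reflMulSL (l l' : Line K) : SL(2, K) :=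
  ⟨l.refl * l'.refl, by rw [Matrix.det_mul, l.det_refl, l'.det_refl]; norm_num⟩

theorem Line.reflMul_eq_mk (l l' : Line K) : l.reflMul l' = (l.reflMulSL l' : PSL(2, K)) := rfl

theorem Line.toGL_reflMulSL (l l' : Line K) :
    Matrix.SpecialLinearGroup.toGL (l.reflMulSL l') = l.reflGL * l'.reflGL :=
  Units.ext rfl

theorem Line.reflMul_inv (l l' : Line K) : (l.reflMul l')⁻¹ = l'.reflMul l := by
  rw [Line.reflMul_eq_mk, Line.reflMul_eq_mk, ← QuotientGroup.mk_inv]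
  congr 1
  rw [inv_eq_iff_mul_eq_one]
  apply Subtype.ext
  change (l.refl * l'.refl) * (l'.refl * l.refl) = 1
  rw [mul_assoc, ← mul_assoc l'.refl, l'.refl_mul_self, one_mul, l.refl_mul_self]

theorem Line.reflMul_mul_reflMul (l l' l'' : Line K) :
    l.reflMul l' * l'.reflMul l'' = l.reflMul l'' := by
  rw [Line.reflMul_eq_mk, Line.reflMul_eq_mk, Line.reflMul_eq_mk, ← QuotientGroup.mk_mul]
  congr 1
  apply Subtype.ext
  change (l.refl * l'.refl) * (l'.refl * l''.refl) = l.refl * l''.refl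
  rw [mul_assoc, ← mul_assoc l'.refl, l'.refl_mul_self, one_mul]

variable [DecidableEq K]

theorem Line.reflGL_smul_reflGL_smul (l : Line K) (p : OnePoint K) :
    l.reflGL • l.reflGL • p = p := by
  rw [smul_smul, l.reflGL_mul_self, one_smul]

theorem Line.reflGL_smul_x (l : Line K) : l.reflGL • l.x = l.x :=
  smul_eq_of_mulVec_eq (c := 1) (by rw [l.coe_reflGL, l.refl_mulVec_x, one_smul])

theorem Line.reflGL_smul_y (l : Line K) : l.reflGL • l.y = l.y :=
  smul_eq_of_mulVec_eq (c := -1) (by rw [l.coe_reflGL, l.refl_mulVec_y, neg_one_smul])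

theorem Line.reflMul_smul (l l' : Line K) (p : OnePoint K) :
    l.reflMul l' • p = l.reflGL • l'.reflGL • p := by
  rw [Line.reflMul_eq_mk, mk_smul, Line.toGL_reflMulSL, mul_smul]

/-- The reflection about the image of a line under a projective map is the conjugate one. -/
theorem Line.reflGL_smul_of_smul_eq (g : GL (Fin 2) K) (l l' : Line K) (hx : g • l.x = l'.x)
    (hy : g • l.y = l'.y) (p : OnePoint K) : l'.reflGL • g • p = g • l.reflGL • p := by
  have hd := det2_ne_zero l.ne
  obtain ⟨c, hc, hcx⟩ := exists_mulVec_homog g l.x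
  obtain ⟨d, hd', hdy⟩ := exists_mulVec_homog g l.y
  have hp : homog p =
      (det2 p l.y / det2 l.x l.y) • homog l.x + (det2 l.x p / det2 l.x l.y) • homog l.y := by
    ext i
    simp only [Pi.add_apply, Pi.smul_apply, smul_eq_mul]
    field_simp
    fin_cases i <;> simp [det2] <;> ring
  rw [smul_smul, smul_smul]
  obtain ⟨e, -, he⟩ := exists_mulVec_homog (g * l.reflGL) p
  refine smul_eq_of_mulVec_eq (c := e) ?_
  rw [← he]
  change (l'.refl * g.1) *ᵥ _ = (g.1 * l.refl) *ᵥ _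
  rw [← Matrix.mulVec_mulVec, ← Matrix.mulVec_mulVec]
  rw [hp]
  simp only [Matrix.mulVec_add, Matrix.mulVec_smul, l.refl_mulVec_x, l.refl_mulVec_y, hcx, hdy, hx,
    hy, l'.refl_mulVec_x, l'.refl_mulVec_y, Matrix.mulVec_neg]
  simp

end Reflections

section ReflectionsOrder

variable {K : Type*} [Field K] [LinearOrder K] [IsStrictOrderedRing K]

theorem Line.cyc_reflGL_smul_iff (l : Line K) (x y z : OnePoint K) :
    Cyc (l.reflGL • x) (l.reflGL • y) (l.reflGL • z) ↔ Cyc z y x :=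
  cyc_smul_iff_of_det_neg (by rw [l.coe_reflGL, l.det_refl]; norm_num) x y z

/-- A reflection exchanges the two open intervals between the endpoints of its line. -/
theorem Line.reflGL_smul_mem_arc {l : Line K} {p : OnePoint K} (h : Cyc l.y p l.x) :
    l.reflGL • p ∈ arc l.x l.y := by
  have := (l.cyc_reflGL_smul_iff l.x p l.y).mpr h
  rwa [l.reflGL_smul_x, l.reflGL_smul_y] at this

end ReflectionsOrder

/-! ### Ping-pong and cyclic orders -/

section PingPong

/-- The letters `0, 1, 2, 3` stand for `a⁻¹, a, b⁻¹, b`; this is the inversion of letters. -/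
def invLetter : Fin 4 → Fin 4 := ![1, 0, 3, 2]

/-- The group element that a letter stands for. -/
def letterElt {G : Type*} [Group G] (a b : G) : Fin 4 → G := ![a⁻¹, a, b⁻¹, b]

theorem letterElt_invLetter {G : Type*} [Group G] (a b : G) (s : Fin 4) :
    letterElt a b (invLetter s) = (letterElt a b s)⁻¹ := by
  fin_cases s <;> simp [letterElt, invLetter]

/-- Three letters in the cyclic order `a⁻¹, a, b⁻¹, b`. -/
def letterCyc (s t u : Fin 4) : Prop :=
  (s < t ∧ t < u) ∨ (t < u ∧ u < s) ∨ (u < s ∧ s < t)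

instance (s t u : Fin 4) : Decidable (letterCyc s t u) := by unfold letterCyc; infer_instance

theorem letterCyc_total : ∀ {s t u : Fin 4}, s ≠ t → t ≠ u → u ≠ s →
    letterCyc s t u ∨ letterCyc t s u := by decide

/-- A ping-pong system: elements `a` and `b` of a group acting on `Z`, sets `S s` indexed by the
letters such that `s` maps `S t` into `S s` unless `t` is the inverse of `s`, a fixed point `p ∈ S
a` of `a`, and an invariant ternary relation `C` that holds for elements of three of the sets
whenever these sets come in the cyclic order `a⁻¹, a, b⁻¹, b`. -/
structure PingPong {G Z : Type*} [Group G] [MulAction G Z] (a b : G) (C : Z → Z → Z → Prop)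
    (S : Fin 4 → Set Z) (p : Z) : Prop where
  mapsTo : ∀ s t, t ≠ invLetter s → ∀ z ∈ S t, letterElt a b s • z ∈ S s
  mem : p ∈ S 1
  fixed : a • p = p
  rot : ∀ x y z, C x y z → C y z x
  inv : ∀ (g : G) x y z, C x y z → C (g • x) (g • y) (g • z)
  cyc : ∀ s t u, letterCyc s t u → ∀ x ∈ S s, ∀ y ∈ S t, ∀ z ∈ S u, C x y z

/-- The first letter of the infinite word `w a a a …`. -/
def firstLetter : List (Fin 4) → Fin 4
  | [] => 1
  | s :: _ => s

/-- Reduced words that do not end in `a` or `a⁻¹`: normal forms for the cosets of the subgroup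
generated by `a` in the free group on `a` and `b`. -/
def GoodWord : List (Fin 4) → Prop
  | [] => True
  | s :: w => GoodWord w ∧ firstLetter w ≠ invLetter s ∧ ¬ (w = [] ∧ s = 1)

theorem GoodWord.tail {w : List (Fin 4)} (h : GoodWord w) : GoodWord w.tail := by
  cases w with
  | nil => exact h
  | cons s w => exact h.1

theorem GoodWord.firstLetter_tail {w : List (Fin 4)} (h : GoodWord w) :
    firstLetter w.tail ≠ invLetter (firstLetter w) := by
  cases w with
  | nil => simp [firstLetter, invLetter]
  | cons s w => exact h.2.1

theorem GoodWord.tail_ne_tail {w w' : List (Fin 4)} (h : GoodWord w) (h' : GoodWord w')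
    (hne : w ≠ w') (hl : firstLetter w = firstLetter w') : w.tail ≠ w'.tail := by
  cases w with
  | nil =>
    cases w' with
    | nil => exact absurd rfl hne
    | cons s w' =>
      intro hw
      exact h'.2.2 ⟨hw.symm, hl.symm⟩
  | cons t w =>
    cases w' with
    | nil =>
      intro hw
      exact h.2.2 ⟨hw, hl⟩
    | cons s w' =>
      intro hw
      exact hne (congrArg₂ _ hl hw)

/-- The group element spelled by a word. -/
def wordElt {G : Type*} [Group G] (a b : G) (w : List (Fin 4)) : G := (w.map (letterElt a b)).prod

variable {G Z : Type*} [Group G] [MulAction G Z] {a b : G} {C : Z → Z → Z → Prop}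
  {S : Fin 4 → Set Z} {p : Z}

theorem PingPong.wordElt_smul (h : PingPong a b C S p) (w : List (Fin 4)) :
    wordElt a b w • p = letterElt a b (firstLetter w) • wordElt a b w.tail • p := by
  cases w with
  | nil => simp [wordElt, firstLetter, letterElt, h.fixed]
  | cons s w => simp [wordElt, firstLetter, mul_smul]

theorem PingPong.wordElt_smul_mem (h : PingPong a b C S p) {w : List (Fin 4)} (hw : GoodWord w) :
    wordElt a b w • p ∈ S (firstLetter w) := by
  induction w with
  | nil => simpa [wordElt, firstLetter] using h.mem
  | cons s w ih =>
    rw [h.wordElt_smul]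
    exact h.mapsTo _ _ hw.2.1 _ (ih hw.1)

theorem PingPong.inv_smul_wordElt (h : PingPong a b C S p) (w : List (Fin 4)) :
    (letterElt a b (firstLetter w))⁻¹ • wordElt a b w • p = wordElt a b w.tail • p := by
  rw [h.wordElt_smul w, inv_smul_smul]

theorem PingPong.of_inv_smul (h : PingPong a b C S p) (g : G) {x y z : Z}
    (hC : C (g⁻¹ • x) (g⁻¹ • y) (g⁻¹ • z)) : C x y z := by
  simpa using h.inv g _ _ _ hC

/-- Two distinct orbit points, together with a point of a set `S t` that contains neither of the
two. Common initial letters of the two words are stripped off one by one; the third point then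
always lies in the set of a letter that differs from the first letters of the two words. -/
theorem PingPong.order_pair (h : PingPong a b C S p) (n : ℕ) :
    ∀ (w w' : List (Fin 4)), w.length + w'.length ≤ n → GoodWord w → GoodWord w' → w ≠ w' →
      ∀ t, t ≠ firstLetter w → t ≠ firstLetter w' → ∀ z ∈ S t,
        C (wordElt a b w • p) (wordElt a b w' • p) z ∨
          C (wordElt a b w' • p) (wordElt a b w • p) z := by
  induction n with
  | zero =>
    intro w w' hn _ _ hne
    have h1 : w = [] := List.length_eq_zero_iff.mp (by omega)
    have h2 : w' = [] := List.length_eq_zero_iff.mp (by omega)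
    exact absurd (h1.trans h2.symm) hne
  | succ n ih =>
    intro w w' hn hw hw' hne t ht ht' z hz
    by_cases hl : firstLetter w = firstLetter w'
    · have hlen : w.tail.length + w'.tail.length ≤ n := by
        have : w ≠ [] ∨ w' ≠ [] := by
          by_contra hcon
          push Not at hcon
          exact hne (hcon.1.trans hcon.2.symm)
        simp only [List.length_tail]
        rcases this with h1 | h1 <;> have := List.length_pos_iff.mpr h1 <;> omega
      have hz' : letterElt a b (invLetter (firstLetter w)) • z ∈ S (invLetter (firstLetter w)) := by
        refine h.mapsTo _ _ ?_ _ hz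
        have : ∀ s : Fin 4, invLetter (invLetter s) = s := by decide
        rwa [this]
      rw [letterElt_invLetter] at hz'
      have := ih w.tail w'.tail hlen hw.tail hw'.tail (hw.tail_ne_tail hw' hne hl) _
        hw.firstLetter_tail.symm (by rw [hl]; exact hw'.firstLetter_tail.symm) _ hz'
      rw [← h.inv_smul_wordElt w, ← h.inv_smul_wordElt w', ← hl] at this
      exact this.imp (h.of_inv_smul _) (h.of_inv_smul _)
    · exact (letterCyc_total hl ht'.symm ht).imp
        (fun hc => h.cyc _ _ _ hc _ (h.wordElt_smul_mem hw) _ (h.wordElt_smul_mem hw') _ hz)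
        (fun hc => h.cyc _ _ _ hc _ (h.wordElt_smul_mem hw') _ (h.wordElt_smul_mem hw) _ hz)

/-- Three pairwise distinct normal forms give three points of the orbit that are in the relation
`C`, in this or in the opposite order. The first letter is stripped off as long as the three first
letters agree; afterwards `order_pair` applies. -/
theorem PingPong.order_words (h : PingPong a b C S p) (n : ℕ) :
    ∀ (u v w : List (Fin 4)), u.length + v.length + w.length ≤ n →
      GoodWord u → GoodWord v → GoodWord w → u ≠ v → v ≠ w → w ≠ u →
        C (wordElt a b u • p) (wordElt a b v • p) (wordElt a b w • p) ∨
          C (wordElt a b v • p) (wordElt a b u • p) (wordElt a b w • p) := by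
  induction n with
  | zero =>
    intro u v w hn _ _ _ hne
    have h1 : u = [] := List.length_eq_zero_iff.mp (by omega)
    have h2 : v = [] := List.length_eq_zero_iff.mp (by omega)
    exact absurd (h1.trans h2.symm) hne
  | succ n ih =>
    intro u v w hn hu hv hw huv hvw hwu
    by_cases h1 : firstLetter w ≠ firstLetter u ∧ firstLetter w ≠ firstLetter v
    · exact h.order_pair _ u v le_rfl hu hv huv _ h1.1 h1.2 _ (h.wordElt_smul_mem hw)
    by_cases h2 : firstLetter u ≠ firstLetter v ∧ firstLetter u ≠ firstLetter w
    · refine (h.order_pair _ v w le_rfl hv hw hvw _ h2.1 h2.2 _ (h.wordElt_smul_mem hu)).imp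
        (fun hc => h.rot _ _ _ (h.rot _ _ _ hc)) (fun hc => h.rot _ _ _ hc)
    by_cases h3 : firstLetter v ≠ firstLetter w ∧ firstLetter v ≠ firstLetter u
    · refine (h.order_pair _ w u le_rfl hw hu hwu _ h3.1 h3.2 _ (h.wordElt_smul_mem hv)).imp
        (fun hc => h.rot _ _ _ hc) (fun hc => h.rot _ _ _ (h.rot _ _ _ hc))
    have hl : firstLetter u = firstLetter v ∧ firstLetter u = firstLetter w := by
      have : ∀ x y z : Fin 4, ¬(z ≠ x ∧ z ≠ y) → ¬(x ≠ y ∧ x ≠ z) → ¬(y ≠ z ∧ y ≠ x) →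
        x = y ∧ x = z := by decide
      exact this _ _ _ h1 h2 h3
    have hlen : u.tail.length + v.tail.length + w.tail.length ≤ n := by
      have : u ≠ [] ∨ v ≠ [] := by
        by_contra hcon
        push Not at hcon
        exact huv (hcon.1.trans hcon.2.symm)
      simp only [List.length_tail]
      rcases this with h1 | h1 <;> have := List.length_pos_iff.mpr h1 <;> omega
    have := ih u.tail v.tail w.tail hlen hu.tail hv.tail hw.tail
      (hu.tail_ne_tail hv huv hl.1) (hv.tail_ne_tail hw hvw (hl.1.symm.trans hl.2))
      (hw.tail_ne_tail hu hwu hl.2.symm)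
    rw [← h.inv_smul_wordElt u, ← h.inv_smul_wordElt v, ← h.inv_smul_wordElt w, ← hl.1,
      ← hl.2] at this
    exact this.imp (h.of_inv_smul _) (h.of_inv_smul _)

/-- Every point of the orbit of `p` under the group generated by `a` and `b` is given by a normal
form. -/
theorem PingPong.exists_goodWord (h : PingPong a b C S p) {g : G}
    (hg : g ∈ Subgroup.closure {a, b}) : ∃ w, GoodWord w ∧ g • p = wordElt a b w • p := by
  have step : ∀ (s : Fin 4) (w : List (Fin 4)), GoodWord w →
      ∃ w', GoodWord w' ∧ letterElt a b s • wordElt a b w • p = wordElt a b w' • p := by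
    intro s w hw
    by_cases h1 : firstLetter w = invLetter s
    · refine ⟨w.tail, hw.tail, ?_⟩
      rw [← h.inv_smul_wordElt w, h1, letterElt_invLetter, inv_inv]
    · by_cases h2 : w = [] ∧ s = 1
      · refine ⟨[], trivial, ?_⟩
        rw [h2.1, h2.2]
        simpa [wordElt, letterElt] using h.fixed
      · refine ⟨s :: w, ⟨hw, h1, h2⟩, ?_⟩
        simp [wordElt, mul_smul]
  induction hg using Subgroup.closure_induction_left with
  | one => exact ⟨[], trivial, by simp [wordElt]⟩
  | mul_left x hx y _ ih =>
    obtain ⟨w, hw, hy⟩ := ih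
    rw [mul_smul, hy]
    rcases hx with rfl | rfl
    · exact step 1 w hw
    · exact step 3 w hw
  | inv_mul_cancel x hx y _ ih =>
    obtain ⟨w, hw, hy⟩ := ih
    rw [mul_smul, hy]
    rcases hx with rfl | rfl
    · exact step 0 w hw
    · exact step 2 w hw

theorem PingPong.order_orbit (h : PingPong a b C S p) (hG : Subgroup.closure {a, b} = ⊤)
    {g₁ g₂ g₃ : G} (h₁₂ : g₁ • p ≠ g₂ • p) (h₂₃ : g₂ • p ≠ g₃ • p) (h₃₁ : g₃ • p ≠ g₁ • p) :
    C (g₁ • p) (g₂ • p) (g₃ • p) ∨ C (g₂ • p) (g₁ • p) (g₃ • p) := by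
  obtain ⟨u, hu, hu'⟩ := h.exists_goodWord (g := g₁) (by rw [hG]; trivial)
  obtain ⟨v, hv, hv'⟩ := h.exists_goodWord (g := g₂) (by rw [hG]; trivial)
  obtain ⟨w, hw, hw'⟩ := h.exists_goodWord (g := g₃) (by rw [hG]; trivial)
  rw [hu', hv'] at h₁₂
  rw [hv', hw'] at h₂₃
  rw [hw', hu'] at h₃₁
  rw [hu', hv', hw']
  exact h.order_words _ u v w le_rfl hu hv hw (fun e => h₁₂ (by rw [e])) (fun e => h₂₃ (by rw [e]))
    (fun e => h₃₁ (by rw [e]))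

/-- Two different points of the orbit are part of a triple in the relation `C`. -/
theorem PingPong.exists_order (h : PingPong a b C S p) (hG : Subgroup.closure {a, b} = ⊤)
    {g₁ g₂ : G} (hne : g₁ • p ≠ g₂ • p) :
    ∃ z, C (g₁ • p) (g₂ • p) z ∨ C (g₂ • p) (g₁ • p) z := by
  obtain ⟨u, hu, hu'⟩ := h.exists_goodWord (g := g₁) (by rw [hG]; trivial)
  obtain ⟨v, hv, hv'⟩ := h.exists_goodWord (g := g₂) (by rw [hG]; trivial)
  have huv : u ≠ v := fun e => hne (by rw [hu', hv', e])
  rw [hu', hv']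
  have h2 : GoodWord [2] := ⟨trivial, by decide, by simp⟩
  have h3 : GoodWord [3] := ⟨trivial, by decide, by simp⟩
  -- at least one of the three words `1`, `b⁻¹`, `b` differs from `u` and `v`
  obtain ⟨w, hw, hwu, hwv⟩ : ∃ w, GoodWord w ∧ w ≠ u ∧ w ≠ v := by
    by_contra! hcon
    by_cases e1 : [] = u
    · have e2 := hcon [2] h2 (by simp [← e1])
      have e3 := hcon [3] h3 (by simp [← e1])
      simpa using e2.trans e3.symm
    · have e2 := hcon [] trivial e1
      have e3 : [2] = u := by
        by_contra e
        simpa using (hcon [2] h2 e).trans e2.symm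
      have e4 : [3] = u := by
        by_contra e
        simpa using (hcon [3] h3 e).trans e2.symm
      simpa using e3.trans e4.symm
  exact ⟨_, h.order_words _ u v w le_rfl hu hv hw huv hwv.symm hwu⟩

end PingPong

section PingPongProd

variable {G X Y : Type*} [Group G] [MulAction G X] [MulAction G Y] {a b : G}

theorem PingPong.prod {C : X → X → X → Prop} {D : Y → Y → Y → Prop} {S : Fin 4 → Set X}
    {T : Fin 4 → Set Y} {p : X} {q : Y} (h : PingPong a b C S p) (h' : PingPong a b D T q) :
    PingPong a b (fun x y z : X × Y => C x.1 y.1 z.1 ∧ D x.2 y.2 z.2) (fun s => S s ×ˢ T s)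
      (p, q) where
  mapsTo s t hst _ hz := ⟨h.mapsTo s t hst _ hz.1, h'.mapsTo s t hst _ hz.2⟩
  mem := ⟨h.mem, h'.mem⟩
  fixed := Prod.ext h.fixed h'.fixed
  rot _ _ _ hC := ⟨h.rot _ _ _ hC.1, h'.rot _ _ _ hC.2⟩
  inv g _ _ _ hC := ⟨h.inv g _ _ _ hC.1, h'.inv g _ _ _ hC.2⟩
  cyc s t u hstu _ hx _ hy _ hz :=
    ⟨h.cyc s t u hstu _ hx.1 _ hy.1 _ hz.1, h'.cyc s t u hstu _ hx.2 _ hy.2 _ hz.2⟩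

end PingPongProd

/-! ### Circular orders and mirror systems -/

section Circular

variable {X : Type*} {C : X → X → X → Prop}

/-- Dense cyclic orders, as ternary relations. -/
structure IsCircular (C : X → X → X → Prop) : Prop where
  rot : ∀ {x y z}, C x y z → C y z x
  asymm : ∀ {x y z}, C x y z → ¬ C z y x
  total : ∀ {x y z}, x ≠ y → y ≠ z → z ≠ x → C x y z ∨ C z y x
  trans : ∀ {x y z w}, C x y z → C x z w → C x y w
  dense : ∀ {x y}, x ≠ y → ∃ w, C x w y

namespace IsCircular

theorem reverse (h : IsCircular C) : IsCircular (fun x y z => C z y x) where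
  rot h1 := h.rot (h.rot h1)
  asymm h1 := h.asymm h1
  total h1 h2 h3 := (h.total h1 h2 h3).symm
  trans h1 h2 := h.rot (h.trans (h.rot (h.rot h2)) (h.rot (h.rot h1)))
  dense hxy := (h.dense hxy.symm)

theorem ne (h : IsCircular C) {x y z : X} (h1 : C x y z) : x ≠ y := by
  rintro rfl
  exact h.asymm (h.rot h1) (h.rot h1)

theorem ne' (h : IsCircular C) {x y z : X} (h1 : C x y z) : y ≠ z := h.ne (h.rot h1)

theorem ne'' (h : IsCircular C) {x y z : X} (h1 : C x y z) : z ≠ x := h.ne' (h.rot h1)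

/-- If two open intervals are disjoint, then the half-open intervals with the same endpoints are
disjoint: the points that follow a common starting point closely enough lie in both intervals. -/
theorem not_mem_of_disjoint (h : IsCircular C) {x y x' y' z : X} (hxy : x ≠ y) (hxy' : x' ≠ y')
    (hd : ∀ w, C x w y → ¬ C x' w y') (hz : z = x ∨ C x z y) (hz' : z = x' ∨ C x' z y') :
    False := by
  have hzy : z ≠ y := by
    rcases hz with rfl | hz
    · exact hxy
    · exact h.ne' hz
  have hzy' : z ≠ y' := by
    rcases hz' with rfl | hz'
    · exact hxy'
    · exact h.ne' hz'
  obtain ⟨w, hw, hw'⟩ : ∃ w, C z w y ∧ C z w y' := by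
    by_cases hyy : y = y'
    · subst hyy
      obtain ⟨w, hw⟩ := h.dense hzy
      exact ⟨w, hw, hw⟩
    · rcases h.total hzy hyy hzy'.symm with h1 | h1
      · obtain ⟨w, hw⟩ := h.dense hzy
        exact ⟨w, hw, h.trans hw h1⟩
      · obtain ⟨w, hw⟩ := h.dense hzy'
        exact ⟨w, h.trans hw (h.rot (h.rot h1)), hw⟩
  have key : ∀ {u v : X}, (z = u ∨ C u z v) → C z w v → C u w v := by
    rintro u v (rfl | h1) h2
    · exact h2
    · exact h.rot (h.trans (h.rot (h.rot h1)) (h.rot (h.rot h2)))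
  exact hd w (key hz hw) (key hz' hw')

/-- The position of two points outside of a half-open interval with respect to a point of the
interval does not depend on the latter. -/
theorem of_mem_of_mem (h : IsCircular C) {x y u v w w' : X} (hxy : x ≠ y)
    (hu : u = x ∨ C x u y) (hv : v = x ∨ C x v y) (hw : ¬ (w = x ∨ C x w y))
    (hw' : ¬ (w' = x ∨ C x w' y)) (hC : C u w w') : C v w w' := by
  have after : ∀ {s z : X}, C x s y → ¬ (z = x ∨ C x z y) → C x s z := by
    intro s z hs hz
    push Not at hz
    by_cases hzy : z = y
    · rwa [hzy]
    · refine h.trans hs ?_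
      rcases h.total hxy (Ne.symm hzy) hz.1 with h1 | h1
      · exact h1
      · exact absurd (h.rot (h.rot h1)) hz.2
  have from_x : ∀ {s z z' : X}, (s = x ∨ C x s y) → ¬ (z = x ∨ C x z y) →
      ¬ (z' = x ∨ C x z' y) → C x z z' → C s z z' := by
    rintro s z z' (rfl | hs) hz hz' hC
    · exact hC
    · exact h.rot (h.rot (h.trans (h.rot hC) (h.rot (h.rot (after hs hz)))))
  refine from_x hv hw hw' ?_
  rcases h.total (Ne.symm (not_or.mp hw).1) (h.ne' hC) (not_or.mp hw').1 with h1 | h1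
  · exact h1
  · exact absurd (h.rot (from_x hu hw' hw (h.rot (h.rot h1)))) (h.asymm hC)

/-- The cyclic order of three points in pairwise disjoint intervals depends only on the
intervals. -/
theorem of_mem_Ico (h : IsCircular C) {x y : Fin 3 → X} (hxy : ∀ i, x i ≠ y i)
    (hd : ∀ i j, i ≠ j → ∀ w, C (x i) w (y i) → ¬ C (x j) w (y j)) {i j k : Fin 3} (hij : i ≠ j)
    (hjk : j ≠ k) (hki : k ≠ i) {u v : Fin 3 → X} (hu : ∀ i, u i = x i ∨ C (x i) (u i) (y i))
    (hv : ∀ i, v i = x i ∨ C (x i) (v i) (y i)) (hC : C (u i) (u j) (u k)) :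
    C (v i) (v j) (v k) := by
  have out : ∀ {i j : Fin 3} {w : X}, i ≠ j → (w = x i ∨ C (x i) w (y i)) →
      ¬ (w = x j ∨ C (x j) w (y j)) := fun hij hw hw' =>
    h.not_mem_of_disjoint (hxy _) (hxy _) (hd _ _ hij) hw hw'
  have h1 := h.of_mem_of_mem (hxy i) (hu i) (hv i) (out hij.symm (hu j)) (out hki (hu k)) hC
  have h2 := h.of_mem_of_mem (hxy j) (hu j) (hv j) (out hjk.symm (hu k)) (out hij (hv i))
    (h.rot h1)
  exact h.rot (h.of_mem_of_mem (hxy k) (hu k) (hv k) (out hki.symm (hv i)) (out hjk (hv j))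
    (h.rot h2))

end IsCircular

/-- A configuration of sets for the group generated by three reflections `r₀, r₁, r₂` of a circle:
`r₀` exchanges the complement of `P` with a subset of `P'` and the complement of `P'` with a subset
of `P`, and likewise `r₁` for `R, R'` and `r₂` for `Q, Q'`; the sets `P, Q, R` and the sets
`P', Q', R'` come in this cyclic order. -/
structure MirrorSystem (C : X → X → X → Prop) (r₀ r₁ r₂ : X → X) (P P' Q Q' R R' : Set X) :
    Prop where
  circ : IsCircular C
  invol : ∀ x, r₁ (r₁ x) = x
  rev : ∀ x y z, C z y x → C (r₁ x) (r₁ y) (r₁ z)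
  out₀ : ∀ x, x ∉ P → r₀ x ∈ P'
  out₀' : ∀ x, x ∉ P' → r₀ x ∈ P
  out₁ : ∀ x, x ∉ R → r₁ x ∈ R'
  out₁' : ∀ x, x ∉ R' → r₁ x ∈ R
  out₂ : ∀ x, x ∉ Q → r₂ x ∈ Q'
  out₂' : ∀ x, x ∉ Q' → r₂ x ∈ Q
  cyc : ∀ x ∈ P, ∀ y ∈ Q, ∀ z ∈ R, C x y z
  cyc' : ∀ x ∈ P', ∀ y ∈ Q', ∀ z ∈ R', C x y z
  nonempty₀ : P.Nonempty
  nonempty₀' : P'.Nonempty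
  nonempty₂ : Q.Nonempty
  nonempty₂' : Q'.Nonempty

namespace MirrorSystem

variable {r₀ r₁ r₂ : X → X} {P P' Q Q' R R' : Set X}

theorem mem_R_of_P' (h : MirrorSystem C r₀ r₁ r₂ P P' Q Q' R R') {x : X} (hx : r₁ x ∈ P') :
    x ∈ R := by
  obtain ⟨y, hy⟩ := h.nonempty₂'
  rw [← h.invol x]
  exact h.out₁' _ fun hx' => h.circ.ne'' (h.cyc' _ hx _ hy _ hx') rfl

theorem mem_R_of_Q' (h : MirrorSystem C r₀ r₁ r₂ P P' Q Q' R R') {x : X} (hx : r₁ x ∈ Q') :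
    x ∈ R := by
  obtain ⟨y, hy⟩ := h.nonempty₀'
  rw [← h.invol x]
  exact h.out₁' _ fun hx' => h.circ.ne' (h.cyc' _ hy _ hx _ hx') rfl

theorem mem_R'_of_Q (h : MirrorSystem C r₀ r₁ r₂ P P' Q Q' R R') {x : X} (hx : x ∈ Q) :
    r₁ x ∈ R' := by
  obtain ⟨y, hy⟩ := h.nonempty₀
  exact h.out₁ _ fun hx' => h.circ.ne' (h.cyc _ hy _ hx _ hx') rfl

theorem mem_R'_of_P (h : MirrorSystem C r₀ r₁ r₂ P P' Q Q' R R') {x : X} (hx : x ∈ P) :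
    r₁ x ∈ R' := by
  obtain ⟨y, hy⟩ := h.nonempty₂
  exact h.out₁ _ fun hx' => h.circ.ne'' (h.cyc _ hx _ hy _ hx') rfl

/-- The ping-pong sets of `a = r₀ r₁` and `b = r₁ r₂` for the letters `a⁻¹, a, b⁻¹, b`. -/
def table (r₁ : X → X) (P P' Q Q' : Set X) : Fin 4 → Set X := ![r₁ ⁻¹' P', P, Q, r₁ ⁻¹' Q']

theorem cyc_table (h : MirrorSystem C r₀ r₁ r₂ P P' Q Q' R R') (s t u : Fin 4)
    (hs : letterCyc s t u) (x : X) (hx : x ∈ table r₁ P P' Q Q' s) (y : X)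
    (hy : y ∈ table r₁ P P' Q Q' t) (z : X) (hz : z ∈ table r₁ P P' Q Q' u) : C x y z := by
  have c012 : ∀ x y z, r₁ x ∈ P' → y ∈ P → z ∈ Q → C x y z := fun x y z hx hy hz =>
    h.circ.rot (h.circ.rot (h.cyc _ hy _ hz _ (h.mem_R_of_P' hx)))
  have c123 : ∀ x y z, x ∈ P → y ∈ Q → r₁ z ∈ Q' → C x y z := fun x y z hx hy hz =>
    h.cyc _ hx _ hy _ (h.mem_R_of_Q' hz)
  have key : ∀ x y z, r₁ x ∈ P' → r₁ y ∈ Q' → r₁ z ∈ R' → C z y x := by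
    intro x y z hx hy hz
    have := h.rev _ _ _ (h.cyc' _ hx _ hy _ hz)
    rwa [h.invol, h.invol, h.invol] at this
  have c013 : ∀ x y z, r₁ x ∈ P' → y ∈ P → r₁ z ∈ Q' → C x y z := fun x y z hx hy hz =>
    h.circ.rot (h.circ.rot (key _ _ _ hx hz (h.mem_R'_of_P hy)))
  have c023 : ∀ x y z, r₁ x ∈ P' → y ∈ Q → r₁ z ∈ Q' → C x y z := fun x y z hx hy hz =>
    h.circ.rot (h.circ.rot (key _ _ _ hx hz (h.mem_R'_of_Q hy)))
  have main : ∀ s t u : Fin 4, s < t ∧ t < u → ∀ x ∈ table r₁ P P' Q Q' s,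
      ∀ y ∈ table r₁ P P' Q Q' t, ∀ z ∈ table r₁ P P' Q Q' u, C x y z := by
    intro s t u hs x hx y hy z hz
    have : ∀ s t u : Fin 4, s < t ∧ t < u → (s = 0 ∧ t = 1 ∧ u = 2) ∨ (s = 0 ∧ t = 1 ∧ u = 3) ∨
        (s = 0 ∧ t = 2 ∧ u = 3) ∨ (s = 1 ∧ t = 2 ∧ u = 3) := by decide
    rcases this s t u hs with ⟨rfl, rfl, rfl⟩ | ⟨rfl, rfl, rfl⟩ | ⟨rfl, rfl, rfl⟩ | ⟨rfl, rfl, rfl⟩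
    · exact c012 x y z hx hy hz
    · exact c013 x y z hx hy hz
    · exact c023 x y z hx hy hz
    · exact c123 x y z hx hy hz
  rcases hs with hs | hs | hs
  · exact main _ _ _ hs _ hx _ hy _ hz
  · exact h.circ.rot (h.circ.rot (main _ _ _ hs _ hy _ hz _ hx))
  · exact h.circ.rot (main _ _ _ hs _ hz _ hx _ hy)

theorem nonempty_table (h : MirrorSystem C r₀ r₁ r₂ P P' Q Q' R R') (s : Fin 4) :
    (table r₁ P P' Q Q' s).Nonempty := by
  have pre : ∀ {T : Set X}, T.Nonempty → (r₁ ⁻¹' T).Nonempty := by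
    rintro T ⟨x, hx⟩
    exact ⟨r₁ x, by simpa [h.invol] using hx⟩
  fin_cases s
  · exact pre h.nonempty₀'
  · exact h.nonempty₀
  · exact h.nonempty₂
  · exact pre h.nonempty₂'

theorem disjoint_table (h : MirrorSystem C r₀ r₁ r₂ P P' Q Q' R R') {s t : Fin 4} (hst : s ≠ t)
    {x : X} (hs : x ∈ table r₁ P P' Q Q' s) (ht : x ∈ table r₁ P P' Q Q' t) : False := by
  have : ∀ s t : Fin 4, s ≠ t → ∃ u, letterCyc s t u ∨ letterCyc t s u := by decide
  obtain ⟨u, hu⟩ := this s t hst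
  obtain ⟨y, hy⟩ := h.nonempty_table u
  rcases hu with hu | hu
  · exact h.circ.ne (h.cyc_table s t u hu x hs x ht y hy) rfl
  · exact h.circ.ne (h.cyc_table t s u hu x ht x hs y hy) rfl

variable {G : Type*} [Group G] [MulAction G X] {a b : G}

theorem out_table (h : MirrorSystem C r₀ r₁ r₂ P P' Q Q' R R') (ha : ∀ x, a • x = r₀ (r₁ x))
    (ha' : ∀ x, a⁻¹ • x = r₁ (r₀ x)) (hb : ∀ x, b • x = r₁ (r₂ x))
    (hb' : ∀ x, b⁻¹ • x = r₂ (r₁ x)) (s : Fin 4) (x : X)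
    (hx : x ∉ table r₁ P P' Q Q' (invLetter s)) :
    letterElt a b s • x ∈ table r₁ P P' Q Q' s := by
  fin_cases s
  · change r₁ (a⁻¹ • x) ∈ P'
    rw [ha', h.invol]
    exact h.out₀ _ hx
  · change a • x ∈ P
    rw [ha]
    exact h.out₀' _ hx
  · change b⁻¹ • x ∈ Q
    rw [hb']
    exact h.out₂' _ hx
  · change r₁ (b • x) ∈ Q'
    rw [hb, h.invol]
    exact h.out₂ _ hx

theorem pingPong (h : MirrorSystem C r₀ r₁ r₂ P P' Q Q' R R') (ha : ∀ x, a • x = r₀ (r₁ x))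
    (ha' : ∀ x, a⁻¹ • x = r₁ (r₀ x)) (hb : ∀ x, b • x = r₁ (r₂ x))
    (hb' : ∀ x, b⁻¹ • x = r₂ (r₁ x)) (inv : ∀ (g : G) x y z, C x y z → C (g • x) (g • y) (g • z))
    {p : X} (hp : p ∈ P) (hfix : a • p = p) : PingPong a b C (table r₁ P P' Q Q') p where
  mapsTo s _ hst z hz := h.out_table ha ha' hb hb' s z fun hz' => h.disjoint_table hst hz hz'
  mem := hp
  fixed := hfix
  rot _ _ _ := h.circ.rot
  inv := inv
  cyc := h.cyc_table

/-- The products of reflections `a = r₀ r₁` and `b = r₁ r₂` freely generate a free group. -/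
theorem injective_freeGroup_lift {G : Type} [Group G] [MulAction G X] {a b : G}
    (h : MirrorSystem C r₀ r₁ r₂ P P' Q Q' R R')
    (ha : ∀ x, a • x = r₀ (r₁ x))
    (ha' : ∀ x, a⁻¹ • x = r₁ (r₀ x)) (hb : ∀ x, b • x = r₁ (r₂ x))
    (hb' : ∀ x, b⁻¹ • x = r₂ (r₁ x)) : Function.Injective (FreeGroup.lift ![a, b]) := by
  have hne := h.nonempty_table
  have hdis : ∀ {s t : Fin 4}, s ≠ t →
      Disjoint (table r₁ P P' Q Q' s) (table r₁ P P' Q Q' t) := fun hst =>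
    Set.disjoint_left.mpr fun x hs ht => h.disjoint_table hst hs ht
  have hout := h.out_table ha ha' hb hb'
  refine FreeGroup.injective_lift_of_ping_pong (α := X) ![a, b]
    (fun i => table r₁ P P' Q Q' (![1, 3] i)) (fun i => table r₁ P P' Q Q' (![0, 2] i))
    (fun i => hne _) ?_ ?_ ?_ ?_ ?_
  · intro i j hij
    apply hdis
    revert hij; revert i j; decide
  · intro i j hij
    apply hdis
    revert hij; revert i j; decide
  · intro i j
    apply hdis
    revert i j; decide
  · intro i
    rintro _ ⟨x, hx, rfl⟩
    fin_cases i
    · exact hout 1 x hx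
    · exact hout 3 x hx
  · intro i
    rintro _ ⟨x, hx, rfl⟩
    fin_cases i
    · exact hout 0 x hx
    · exact hout 2 x hx

end MirrorSystem

end Circular

/-! ### Limit sets -/

section LimitSet

open Filter Topology

theorem toGL_smul_infty {K : Type*} [Field K] [DecidableEq K] (h : SL(2, K)) :
    Matrix.SpecialLinearGroup.toGL h • (∞ : OnePoint K) =
      if h.1 1 0 = 0 then ∞ else ((h.1 0 0 / h.1 1 0 : K) : OnePoint K) :=
  smul_infty_eq_ite _

/-- A Möbius transformation takes a sequence of the upper half plane that tends to `∞` to a sequence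
that tends to the image of `∞`. -/
theorem tendsto_smul_of_tendsto_cobounded (h : SL(2, ℝ)) {z : ℕ → UpperHalfPlane}
    (hz : Tendsto (fun n => (z n : ℂ)) atTop (Bornology.cobounded ℂ)) :
    Tendsto (fun n => (((h • z n : UpperHalfPlane) : ℂ) : OnePoint ℂ)) atTop
      (𝓝 ((Matrix.SpecialLinearGroup.toGL h • (∞ : OnePoint ℝ)).map (fun t : ℝ => (t : ℂ)))) := by
  have hdet := h.2
  rw [Matrix.det_fin_two] at hdet
  have e : ∀ n, ((h • z n : UpperHalfPlane) : ℂ) =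
      ((h.1 0 0 : ℝ) * (z n : ℂ) + (h.1 0 1 : ℝ)) / ((h.1 1 0 : ℝ) * (z n : ℂ) + (h.1 1 1 : ℝ)) :=
    fun n => UpperHalfPlane.coe_specialLinearGroup_apply h (z n)
  simp only [e]
  rw [toGL_smul_infty]
  by_cases hc : h.1 1 0 = 0
  · rw [if_pos hc, OnePoint.map_infty]
    have ha : h.1 0 0 ≠ 0 := by rintro h0; rw [h0, hc] at hdet; simp at hdet
    have hd : h.1 1 1 ≠ 0 := by rintro h0; rw [h0, hc] at hdet; simp at hdet
    simp only [hc, Complex.ofReal_zero, zero_mul, zero_add]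
    refine OnePoint.tendsto_coe_infty.comp ?_
    rw [Filter.coclosedCompact_eq_cocompact, ← Metric.cobounded_eq_cocompact]
    have h1 := (Filter.tendsto_mul_left_cobounded (Complex.ofReal_ne_zero.mpr ha)).comp hz
    have h2 := (tendsto_add_const_cobounded ((h.1 0 1 : ℝ) : ℂ)).comp h1
    exact (Filter.tendsto_mul_right_cobounded (inv_ne_zero (Complex.ofReal_ne_zero.mpr hd))).comp h2
  · rw [if_neg hc, OnePoint.map_some]
    refine (OnePoint.continuous_coe.tendsto _).comp ?_
    have hinv : Tendsto (fun n => (z n : ℂ)⁻¹) atTop (𝓝 0) :=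
      Filter.tendsto_inv₀_cobounded.comp hz
    have h1 : Tendsto (fun n => (((h.1 0 0 : ℝ) : ℂ) + (h.1 0 1 : ℝ) * (z n : ℂ)⁻¹) /
        (((h.1 1 0 : ℝ) : ℂ) + (h.1 1 1 : ℝ) * (z n : ℂ)⁻¹)) atTop
        (𝓝 ((((h.1 0 0 : ℝ) : ℂ) + (h.1 0 1 : ℝ) * 0) /
          (((h.1 1 0 : ℝ) : ℂ) + (h.1 1 1 : ℝ) * 0))) :=
      (tendsto_const_nhds.add (tendsto_const_nhds.mul hinv)).div
        (tendsto_const_nhds.add (tendsto_const_nhds.mul hinv)) (by simpa using hc)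
    rw [mul_zero, mul_zero, add_zero, add_zero, ← Complex.ofReal_div] at h1
    refine h1.congr fun n => ?_
    have hzn : (z n : ℂ) ≠ 0 := UpperHalfPlane.ne_zero (z n)
    rw [← mul_div_mul_right _ _ hzn]
    congr 1 <;> field_simp

/-- The powers of an upper triangular matrix that acts as an expansion or as a non-trivial
translation move every point of the upper half plane to `∞`. -/
theorem tendsto_pow_smul_cobounded {U : SL(2, ℝ)} (hc : U.1 1 0 = 0)
    (hU : 1 < U.1 0 0 ^ 2 ∨ (U.1 0 0 ^ 2 = 1 ∧ U.1 0 1 ≠ 0)) (w : UpperHalfPlane) :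
    Tendsto (fun n : ℕ => ((U ^ n • w : UpperHalfPlane) : ℂ)) atTop (Bornology.cobounded ℂ) := by
  have hdet := U.2
  rw [Matrix.det_fin_two, hc, mul_zero, sub_zero] at hdet
  have ht : U.1 0 0 ≠ 0 := by rintro h0; rw [h0] at hdet; simp at hdet
  have e : ∀ z : UpperHalfPlane, ((U • z : UpperHalfPlane) : ℂ) =
      ((U.1 0 0 ^ 2 : ℝ) : ℂ) * z + (U.1 0 0 * U.1 0 1 : ℝ) := by
    intro z
    rw [UpperHalfPlane.coe_specialLinearGroup_apply]
    have h1 : U.1 1 1 = (U.1 0 0)⁻¹ := eq_inv_of_mul_eq_one_right hdet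
    have ht' : ((U.1 0 0 : ℝ) : ℂ) ≠ 0 := Complex.ofReal_ne_zero.mpr ht
    simp only [Algebra.algebraMap_self, RingHom.id_apply, h1, hc]
    push_cast
    field_simp
    ring
  rw [← tendsto_norm_atTop_iff_cobounded]
  rcases hU with hU | ⟨hU, hs⟩
  · have him : ∀ n : ℕ, ((U ^ n • w : UpperHalfPlane) : ℂ).im = (U.1 0 0 ^ 2) ^ n * w.im := by
      intro n
      induction n with
      | zero => simp
      | succ n ih =>
        rw [pow_succ', mul_smul, e, Complex.add_im, Complex.ofReal_im, Complex.im_ofReal_mul, ih]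
        ring
    refine tendsto_atTop_mono (fun n => (le_abs_self _).trans (Complex.abs_im_le_norm _)) ?_
    simp only [him]
    exact (tendsto_pow_atTop_atTop_of_one_lt hU).atTop_mul_const w.im_pos
  · have hre : ∀ n : ℕ, ((U ^ n • w : UpperHalfPlane) : ℂ) =
        w + ((n * (U.1 0 0 * U.1 0 1) : ℝ) : ℂ) := by
      intro n
      induction n with
      | zero => simp
      | succ n ih =>
        rw [pow_succ', mul_smul, e, ih, hU]
        push_cast
        ring
    rw [tendsto_norm_atTop_iff_cobounded]
    simp only [hre]
    refine (tendsto_const_add_cobounded (w : ℂ)).comp ?_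
    rw [← tendsto_norm_atTop_iff_cobounded]
    simp only [Complex.norm_real, norm_mul, Real.norm_natCast]
    exact tendsto_natCast_atTop_atTop.atTop_mul_const (by positivity)

theorem exists_toGL_smul_infty (p : OnePoint ℝ) :
    ∃ g : SL(2, ℝ), Matrix.SpecialLinearGroup.toGL g • (∞ : OnePoint ℝ) = p := by
  induction p using OnePoint.rec with
  | infty => exact ⟨1, by simp⟩
  | coe x =>
    refine ⟨⟨!![x, -1; 1, 0], by simp⟩, ?_⟩
    exact (toGL_smul_infty _).trans (by simp)

/-- The orbit of a fixed point of a non-trivial element of the group is contained in the limit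
set. -/
theorem smul_mem_limitSet {Γ : Subgroup PSL(2, ℝ)} {α γ : PSL(2, ℝ)} (hα : α ∈ Γ) (hne : α ≠ 1)
    {p : OnePoint ℝ} (hp : α • p = p) (hγ : γ ∈ Γ) : γ • p ∈ limitSet Γ := by
  obtain ⟨B, rfl⟩ := QuotientGroup.mk_surjective γ
  obtain ⟨g, hg⟩ := exists_toGL_smul_infty p
  -- it suffices to find a lift of an element of `Γ` whose conjugate by `g` moves all points to `∞`
  suffices h : ∃ A : SL(2, ℝ), (A : PSL(2, ℝ)) ∈ Γ ∧ (g⁻¹ * A * g).1 1 0 = 0 ∧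
      (1 < (g⁻¹ * A * g).1 0 0 ^ 2 ∨
        ((g⁻¹ * A * g).1 0 0 ^ 2 = 1 ∧ (g⁻¹ * A * g).1 0 1 ≠ 0)) by
    obtain ⟨A, hA, hc, hU⟩ := h
    have h1 := tendsto_smul_of_tendsto_cobounded (B * g)
      (tendsto_pow_smul_cobounded hc hU (g⁻¹ • UpperHalfPlane.I))
    rw [map_mul, mul_smul, hg] at h1
    refine mem_closure_of_tendsto h1 (Eventually.of_forall fun n => ?_)
    refine ⟨B * A ^ n, ?_, ?_⟩
    · rw [QuotientGroup.mk_mul, QuotientGroup.mk_pow]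
      exact Γ.mul_mem hγ (Γ.pow_mem hA n)
    · have : (g⁻¹ * A * g) ^ n = g⁻¹ * A ^ n * g := by
        simpa using conj_pow (i := n) (a := g⁻¹) (b := A)
      rw [this]
      simp only [← mul_smul]
      congr 3
      group
  obtain ⟨A, rfl⟩ := QuotientGroup.mk_surjective α
  have key : ∀ A : SL(2, ℝ), (A : PSL(2, ℝ)) • p = p → (g⁻¹ * A * g).1 1 0 = 0 := by
    intro A hA
    rw [mk_smul, ← hg, ← mul_smul, ← map_mul] at hA
    have h1 : Matrix.SpecialLinearGroup.toGL (g⁻¹ * A * g) • (∞ : OnePoint ℝ) = ∞ := by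
      rw [mul_assoc, map_mul, mul_smul, hA, ← mul_smul, ← map_mul, inv_mul_cancel, map_one,
        one_smul]
    exact smul_infty_eq_self_iff.mp h1
  have hc := key A hp
  have hc' := key A⁻¹ (by rw [QuotientGroup.mk_inv, inv_smul_eq_iff]; exact hp.symm)
  have hinv : g⁻¹ * A⁻¹ * g = (g⁻¹ * A * g)⁻¹ := by group
  have hdet := (g⁻¹ * A * g).2
  rw [Matrix.det_fin_two, hc, mul_zero, sub_zero] at hdet
  rcases lt_trichotomy ((g⁻¹ * A * g).1 0 0 ^ 2) 1 with h1 | h1 | h1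
  · refine ⟨A⁻¹, by rw [QuotientGroup.mk_inv]; exact Γ.inv_mem hα, hc', Or.inl ?_⟩
    rw [hinv, Matrix.SpecialLinearGroup.coe_inv, Matrix.adjugate_fin_two]
    simp only [Matrix.of_apply, Matrix.cons_val', Matrix.cons_val_zero, Matrix.cons_val_fin_one]
    have h2 : (g⁻¹ * A * g).1 0 0 ^ 2 * (g⁻¹ * A * g).1 1 1 ^ 2 = 1 := by
      rw [← mul_pow, hdet, one_pow]
    by_contra h3
    push Not at h3
    nlinarith [sq_nonneg ((g⁻¹ * A * g).1 0 0), sq_nonneg ((g⁻¹ * A * g).1 1 1)]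
  · refine ⟨A, hα, hc, Or.inr ⟨h1, fun h2 => hne ?_⟩⟩
    -- otherwise `A` is conjugate to a scalar matrix
    have h3 : (g⁻¹ * A * g).1 1 1 = (g⁻¹ * A * g).1 0 0 := by
      linear_combination (g⁻¹ * A * g).1 0 0 * hdet - (g⁻¹ * A * g).1 1 1 * h1
    have h4 : g⁻¹ * A * g ∈ Subgroup.center SL(2, ℝ) := by
      rw [Matrix.SpecialLinearGroup.mem_center_iff]
      refine ⟨(g⁻¹ * A * g).1 0 0, by simpa using h1, ?_⟩
      ext i j
      fin_cases i <;> fin_cases j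
      · simp
      · simpa using h2.symm
      · simpa using hc.symm
      · simpa using h3.symm
    rw [QuotientGroup.eq_one_iff]
    have h5 := (inferInstance : (Subgroup.center SL(2, ℝ)).Normal).conj_mem _ h4 g
    simpa [mul_assoc] using h5
  · exact ⟨A, hα, hc, Or.inl h1⟩

end LimitSet

/-! ### Fixed points of products of two reflections -/

section FixedPoints

variable {K : Type*} [Field K]

theorem Line.trace_refl_mul_refl (l l' : Line K) :
    (l.refl * l'.refl).trace ^ 2 - 4 =
      16 * (det2 l.x l'.x * det2 l.y l'.x * det2 l.x l'.y * det2 l.y l'.y) /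
        (det2 l.x l.y * det2 l'.x l'.y) ^ 2 := by
  have h := det2_ne_zero l.ne
  have h' := det2_ne_zero l'.ne
  simp only [Line.refl, Matrix.smul_mul, Matrix.mul_smul, Matrix.mul_fin_two, Matrix.trace_smul,
    Matrix.trace_fin_two_of, smul_eq_mul]
  field_simp
  simp only [det2]
  ring

theorem Line.trace_refl_mul_refl_eq_crossRatio (l l' : Line K) :
    (l.refl * l'.refl).trace = 4 * crossRatio l'.x l'.y l.y l.x - 2 := by
  have h := det2_ne_zero l.ne
  have h' := det2_ne_zero l'.ne
  have h'' := det2_ne_zero l.ne.symm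
  rw [det2_swap l.x l.y] at h''
  simp only [Line.refl, Matrix.smul_mul, Matrix.mul_smul, Matrix.mul_fin_two, Matrix.trace_smul,
    Matrix.trace_fin_two_of, smul_eq_mul, crossRatio]
  rw [det2_swap l.x l.y]
  field_simp
  simp only [det2]
  ring

theorem exists_smul_eq_self [DecidableEq K] [NeZero (2 : K)] {g : GL (Fin 2) K}
    (h : IsSquare (g.1.trace ^ 2 - 4 * g.1.det)) : ∃ p : OnePoint K, g • p = p := by
  obtain ⟨s, hs⟩ := h
  rw [Matrix.trace_fin_two, Matrix.det_fin_two] at hs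
  by_cases hc : g.1 1 0 = 0
  · exact ⟨∞, smul_infty_eq_self_iff.mpr hc⟩
  · have h2 : (2 : K) ≠ 0 := two_ne_zero
    have hz : ∀ z : K, g.1 1 0 * (z * z) + (g.1 1 1 - g.1 0 0) * z + -g.1 0 1 = 0 →
        g • (z : OnePoint K) = z := by
      intro z hz
      rw [← Matrix.GeneralLinearGroup.fixpointPolynomial_aeval_eq_zero_iff]
      simp [Matrix.GeneralLinearGroup.fixpointPolynomial]
      linear_combination hz
    obtain ⟨z, hz'⟩ := exists_quadratic_eq_zero hc
      (b := g.1 1 1 - g.1 0 0) (c := -g.1 0 1) ⟨s, by rw [discrim]; linear_combination hs⟩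
    exact ⟨z, hz z hz'⟩

variable [LinearOrder K] [IsStrictOrderedRing K]

/-- If a line does not separate the endpoints of another one, then the product of the two
reflections has a fixed point, as soon as non-negative elements are squares. -/
theorem Line.exists_reflGL_smul_eq (hsq : ∀ x : K, 0 ≤ x → IsSquare x) (l l' : Line K)
    (hx : l'.x ∉ arc l.x l.y) (hy : l'.y ∉ arc l.x l.y) :
    ∃ p : OnePoint K, l.reflGL • p = l'.reflGL • p := by
  obtain ⟨p, hp⟩ : ∃ p : OnePoint K, (l.reflGL * l'.reflGL) • p = p := by
    refine exists_smul_eq_self (hsq _ ?_)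
    have hdet : (l.reflGL * l'.reflGL).1.det = 1 := by
      change (l.refl * l'.refl).det = 1
      rw [Matrix.det_mul, l.det_refl, l'.det_refl]; norm_num
    rw [hdet, mul_one]
    change 0 ≤ (l.refl * l'.refl).trace ^ 2 - 4
    rw [l.trace_refl_mul_refl]
    refine div_nonneg (mul_nonneg (by norm_num) ?_) (sq_nonneg _)
    change ¬ Cyc _ _ _ at hx hy
    rw [cyc_iff, not_lt] at hx hy
    have h1 := mul_nonneg_of_nonpos_of_nonpos hx hy
    have h2 := det2_ne_zero l.ne
    have h3 : 0 < det2 l.x l.y ^ 2 := by positivity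
    refine nonneg_of_mul_nonneg_left (a := _) (b := det2 l.x l.y ^ 2) ?_ h3
    rw [det2_swap l.x l.y, det2_swap l.y l'.x, det2_swap l.y l'.y] at h1
    linarith
  refine ⟨p, ?_⟩
  rw [mul_smul] at hp
  nth_rewrite 1 [← hp]
  rw [l.reflGL_smul_reflGL_smul]

end FixedPoints

/-! ### Groups generated by reflections about hyperbolic triples -/

section Hyperbolic

theorem isCircular_cyc {K : Type*} [Field K] [LinearOrder K] [IsStrictOrderedRing K] :
    IsCircular (Cyc : OnePoint K → OnePoint K → OnePoint K → Prop) where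
  rot h := h.rot
  asymm h := h.asymm
  total h1 h2 h3 := cyc_total h1 h2 h3
  trans h1 h2 := h1.trans h2
  dense {x y} hxy := by
    induction x using OnePoint.rec with
    | infty =>
      induction y using OnePoint.rec with
      | infty => exact absurd rfl hxy
      | coe b => exact ⟨((b - 1 : K) : OnePoint K), by simp [Cyc, ltTop]⟩
    | coe a =>
      induction y using OnePoint.rec with
      | infty => exact ⟨((a + 1 : K) : OnePoint K), by simp [Cyc, ltTop]⟩
      | coe b =>
        have hab : a ≠ b := fun e => hxy (by rw [e])
        rcases lt_or_gt_of_ne hab with h | h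
        · exact ⟨(((a + b) / 2 : K) : OnePoint K),
            Or.inl ⟨left_lt_add_div_two.mpr h, add_div_two_lt_right.mpr h⟩⟩
        · exact ⟨∞, by simpa [Cyc, ltTop] using h⟩

/-- The half-open interval `[x, y)` of the cyclic order. -/
def arcIco (l : Line ℝ) : Set (OnePoint ℝ) := {w | w = l.x ∨ Cyc l.x w l.y}

/-- The half-open interval `(x, y]` of the cyclic order. -/
def arcIoc (l : Line ℝ) : Set (OnePoint ℝ) := {w | w = l.y ∨ Cyc l.x w l.y}

theorem reflGL_smul_mem_arcIco {l : Line ℝ} {p : OnePoint ℝ} (hp : p ∉ arcIoc l) :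
    l.reflGL • p ∈ arcIco l := by
  by_cases hx : p = l.x
  · rw [hx, l.reflGL_smul_x]
    exact Or.inl rfl
  · obtain ⟨hy, hp⟩ := not_or.mp hp
    rcases cyc_total (Ne.symm hx) hy l.ne.symm with h | h
    · exact absurd h hp
    · exact Or.inr (l.reflGL_smul_mem_arc h)

theorem reflGL_smul_mem_arcIoc {l : Line ℝ} {p : OnePoint ℝ} (hp : p ∉ arcIco l) :
    l.reflGL • p ∈ arcIoc l := by
  by_cases hy : p = l.y
  · rw [hy, l.reflGL_smul_y]
    exact Or.inl rfl
  · obtain ⟨hx, hp⟩ := not_or.mp hp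
    rcases cyc_total (Ne.symm hx) hy l.ne.symm with h | h
    · exact absurd h hp
    · exact Or.inr (l.reflGL_smul_mem_arc h)

theorem MirrorSystem.symm {X : Type*} {C : X → X → X → Prop} {r₀ r₁ r₂ : X → X}
    {P P' Q Q' R R' : Set X} (h : MirrorSystem C r₀ r₁ r₂ P P' Q Q' R R') :
    MirrorSystem C r₀ r₁ r₂ P' P Q' Q R' R :=
  ⟨h.circ, h.invol, h.rev, h.out₀', h.out₀, h.out₁', h.out₁, h.out₂', h.out₂, h.cyc', h.cyc,
    h.nonempty₀', h.nonempty₀, h.nonempty₂', h.nonempty₂⟩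

/-- The half-open intervals of a hyperbolic triple form a mirror system, for the cyclic order or
for its reverse. -/
theorem exists_mirrorSystem_of_isHyperbolicTriple {l : Fin 3 → Line ℝ}
    (hl : IsHyperbolicTriple l) :
    ∃ C : OnePoint ℝ → OnePoint ℝ → OnePoint ℝ → Prop,
      (C = Cyc ∨ C = fun x y z => Cyc z y x) ∧
      MirrorSystem C ((l 0).reflGL • ·) ((l 1).reflGL • ·) ((l 2).reflGL • ·)
        (arcIoc (l 0)) (arcIco (l 0)) (arcIoc (l 2)) (arcIco (l 2)) (arcIoc (l 1))
        (arcIco (l 1)) := by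
  have circ := isCircular_cyc (K := ℝ)
  have hd : ∀ i j, i ≠ j → ∀ w, Cyc (l i).x w (l i).y → ¬ Cyc (l j).x w (l j).y :=
    fun i j hij w hw hw' => Set.disjoint_left.mp (hl hij) hw hw'
  choose w hw using fun i => circ.dense (l i).ne
  have ico : ∀ {i j k : Fin 3}, i ≠ j → j ≠ k → k ≠ i → Cyc (w i) (w j) (w k) →
      ∀ x ∈ arcIco (l i), ∀ y ∈ arcIco (l j), ∀ z ∈ arcIco (l k), Cyc x y z := by
    intro i j k hij hjk hki hC x hx y hy z hz
    have := circ.of_mem_Ico (x := fun i => (l i).x) (y := fun i => (l i).y) (fun i => (l i).ne) hd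
      hij hjk hki (u := w) (v := fun m => if m = i then x else if m = j then y else if m = k then z
        else w m) (fun i => Or.inr (hw i)) (by
        intro m
        split_ifs with h1 h2 h3
        · subst h1; exact hx
        · subst h2; exact hy
        · subst h3; exact hz
        · exact Or.inr (hw m)) hC
    simpa [hij.symm, hjk.symm, hki] using this
  -- the intervals `(x, y]` are of the form `[y, x)` for the reverse order
  have ioc : ∀ {i j k : Fin 3}, i ≠ j → j ≠ k → k ≠ i → Cyc (w i) (w j) (w k) →
      ∀ x ∈ arcIoc (l i), ∀ y ∈ arcIoc (l j), ∀ z ∈ arcIoc (l k), Cyc x y z := by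
    intro i j k hij hjk hki hC x hx y hy z hz
    have := circ.reverse.of_mem_Ico (x := fun i => (l i).y) (y := fun i => (l i).x)
      (fun i => (l i).ne.symm) hd
      hjk.symm hij.symm hki.symm (u := w) (v := fun m => if m = i then x else if m = j then y else
        if m = k then z else w m) (fun i => Or.inr (hw i)) (by
        intro m
        split_ifs with h1 h2 h3
        · subst h1; exact hx
        · subst h2; exact hy
        · subst h3; exact hz
        · exact Or.inr (hw m)) hC
    simpa [hij.symm, hjk.symm, hki] using this
  have hne : ∀ {i j}, i ≠ j → w i ≠ w j := fun hij e => hd _ _ hij _ (hw _) (e ▸ hw _)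
  have inv : ∀ x, (l 1).reflGL • (l 1).reflGL • x = x := (l 1).reflGL_smul_reflGL_smul
  have out := fun i p => reflGL_smul_mem_arcIco (l := l i) (p := p)
  have out' := fun i p => reflGL_smul_mem_arcIoc (l := l i) (p := p)
  have nonempty : ∀ i, (arcIoc (l i)).Nonempty := fun i => ⟨_, Or.inl rfl⟩
  have nonempty' : ∀ i, (arcIco (l i)).Nonempty := fun i => ⟨_, Or.inl rfl⟩
  rcases cyc_total (hne (show (0 : Fin 3) ≠ 2 by decide)) (hne (show (2 : Fin 3) ≠ 1 by decide))
    (hne (show (1 : Fin 3) ≠ 0 by decide)) with h | h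
  · exact ⟨Cyc, Or.inl rfl, circ, inv, fun x y z h => ((l 1).cyc_reflGL_smul_iff x y z).mpr h,
      out 0, out' 0, out 1, out' 1, out 2, out' 2,
      ioc (by decide) (by decide) (by decide) h, ico (by decide) (by decide) (by decide) h,
      nonempty 0, nonempty' 0, nonempty 2, nonempty' 2⟩
  · exact ⟨_, Or.inr rfl, circ.reverse, inv,
      fun x y z h => ((l 1).cyc_reflGL_smul_iff z y x).mpr h,
      out 0, out' 0, out 1, out' 1, out 2, out' 2,
      fun x hx y hy z hz => ioc (by decide) (by decide) (by decide) h z hz y hy x hx,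
      fun x hx y hy z hz => ico (by decide) (by decide) (by decide) h z hz y hy x hx,
      nonempty 0, nonempty' 0, nonempty 2, nonempty' 2⟩

theorem closure_genA_genB (l : Fin 3 → Line ℝ) : Subgroup.closure {genA l, genB l} = ⊤ := by
  have : ({genA l, genB l} : Set (threeHoledSphereGroup l)) =
      Subtype.val ⁻¹' {(l 0).reflMul (l 1), (l 1).reflMul (l 2)} := by
    ext g
    exact or_congr Subtype.ext_iff Subtype.ext_iff
  rw [this]
  exact Subgroup.closure_closure_coe_preimage

theorem genA_smul (l : Fin 3 → Line ℝ) (p : OnePoint ℝ) :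
    genA l • p = (l 0).reflGL • (l 1).reflGL • p := (l 0).reflMul_smul (l 1) p

theorem genB_smul (l : Fin 3 → Line ℝ) (p : OnePoint ℝ) :
    genB l • p = (l 1).reflGL • (l 2).reflGL • p := (l 1).reflMul_smul (l 2) p

theorem genA_inv_smul (l : Fin 3 → Line ℝ) (p : OnePoint ℝ) :
    (genA l)⁻¹ • p = (l 1).reflGL • (l 0).reflGL • p := by
  rw [inv_smul_eq_iff, genA_smul, Line.reflGL_smul_reflGL_smul, Line.reflGL_smul_reflGL_smul]

theorem genB_inv_smul (l : Fin 3 → Line ℝ) (p : OnePoint ℝ) :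
    (genB l)⁻¹ • p = (l 2).reflGL • (l 1).reflGL • p := by
  rw [inv_smul_eq_iff, genB_smul, Line.reflGL_smul_reflGL_smul, Line.reflGL_smul_reflGL_smul]

/-- A three-holed sphere group plays ping-pong on the circle, with a fixed point of `a` as base
point. -/
theorem exists_pingPong_of_isHyperbolicTriple {l : Fin 3 → Line ℝ} (hl : IsHyperbolicTriple l) :
    ∃ (C : OnePoint ℝ → OnePoint ℝ → OnePoint ℝ → Prop) (S : Fin 4 → Set (OnePoint ℝ))
      (p : OnePoint ℝ), (C = Cyc ∨ C = fun x y z => Cyc z y x) ∧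
      PingPong (genA l) (genB l) C S p ∧ ∀ γ : threeHoledSphereGroup l,
        γ • p ∈ limitSet (threeHoledSphereGroup l) := by
  obtain ⟨C, hC, hM⟩ := exists_mirrorSystem_of_isHyperbolicTriple hl
  have circ := isCircular_cyc (K := ℝ)
  have out : ∀ z, (z = (l 1).x ∨ Cyc (l 1).x z (l 1).y) → z ∉ arc (l 0).x (l 0).y := by
    intro z hz hz'
    exact circ.not_mem_of_disjoint (l 0).ne (l 1).ne
      (fun w hw hw' => Set.disjoint_left.mp (hl (show (0 : Fin 3) ≠ 1 by decide)) hw hw')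
      (Or.inr hz') hz
  have out' : ∀ z, (z = (l 1).y ∨ Cyc (l 1).x z (l 1).y) → z ∉ arc (l 0).x (l 0).y := by
    intro z hz hz'
    exact circ.reverse.not_mem_of_disjoint (l 0).ne.symm (l 1).ne.symm
      (fun w hw hw' => Set.disjoint_left.mp (hl (show (0 : Fin 3) ≠ 1 by decide)) hw hw')
      (Or.inr hz') hz
  obtain ⟨p₀, hp₀⟩ := (l 0).exists_reflGL_smul_eq
    (fun x hx => ⟨√x, (Real.mul_self_sqrt hx).symm⟩) (l 1) (out _ (Or.inl rfl))
    (out' _ (Or.inl rfl))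
  -- one of the two fixed points of `a` lies in the closed interval of the first line
  obtain ⟨p, hp, hmem⟩ : ∃ p, (l 0).reflGL • p = (l 1).reflGL • p ∧
      (p ∈ arcIco (l 0) ∨ p ∈ arcIoc (l 0)) := by
    by_cases h : p₀ ∈ arcIco (l 0)
    · exact ⟨p₀, hp₀, Or.inl h⟩
    · refine ⟨(l 0).reflGL • p₀, ?_, Or.inr (reflGL_smul_mem_arcIoc h)⟩
      rw [Line.reflGL_smul_reflGL_smul, hp₀, Line.reflGL_smul_reflGL_smul]
  have hfix : genA l • p = p := by
    rw [genA_smul, ← hp, Line.reflGL_smul_reflGL_smul]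
  have hinv : ∀ (g : threeHoledSphereGroup l) x y z, C x y z → C (g • x) (g • y) (g • z) := by
    intro g x y z h
    rcases hC with rfl | rfl
    · exact (cyc_psl_smul_iff (g : PSL(2, ℝ)) x y z).mpr h
    · exact (cyc_psl_smul_iff (g : PSL(2, ℝ)) z y x).mpr h
  have main : ∀ {P P' Q Q' R R' : Set (OnePoint ℝ)}, p ∈ P →
      MirrorSystem C ((l 0).reflGL • ·) ((l 1).reflGL • ·) ((l 2).reflGL • ·) P P' Q Q' R R' →
      ∃ S, PingPong (genA l) (genB l) C S p ∧ ∀ γ : threeHoledSphereGroup l,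
        γ • p ∈ limitSet (threeHoledSphereGroup l) := by
    intro P P' Q Q' R R' hp h
    have hpp := h.pingPong (genA_smul l) (genA_inv_smul l) (genB_smul l) (genB_inv_smul l) hinv
      hp hfix
    refine ⟨_, hpp, fun γ => smul_mem_limitSet (genA l).2 ?_ hfix γ.2⟩
    intro h1
    have h1' : genA l = 1 := Subtype.ext h1
    obtain ⟨x, hx⟩ := h.nonempty_table 2
    have h2 := hpp.mapsTo 1 2 (by decide) x hx
    simp only [letterElt, Matrix.cons_val_one, Matrix.cons_val_zero, h1', one_smul] at h2
    exact h.disjoint_table (show (2 : Fin 4) ≠ 1 by decide) hx h2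
  rcases hmem with hmem | hmem
  · obtain ⟨S, hS⟩ := main hmem hM.symm
    exact ⟨C, S, p, hC, hS⟩
  · obtain ⟨S, hS⟩ := main hmem hM
    exact ⟨C, S, p, hC, hS⟩

/-- Three-holed sphere groups are free on `a` and `b`. -/
theorem exists_hom_threeHoledSphereGroup {l : Fin 3 → Line ℝ} (hl : IsHyperbolicTriple l)
    {H : Type*} [Group H] (x y : H) :
    ∃ ρ : threeHoledSphereGroup l →* H, ρ (genA l) = x ∧ ρ (genB l) = y := by
  obtain ⟨C, -, hM⟩ := exists_mirrorSystem_of_isHyperbolicTriple hl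
  have hinj := hM.injective_freeGroup_lift (genA_smul l) (genA_inv_smul l) (genB_smul l)
    (genB_inv_smul l)
  have hsurj : Function.Surjective (FreeGroup.lift ![genA l, genB l]) := by
    rw [← MonoidHom.range_eq_top, ← top_le_iff, ← closure_genA_genB l, Subgroup.closure_le]
    rintro _ (rfl | rfl)
    · exact ⟨FreeGroup.of 0, by simp⟩
    · exact ⟨FreeGroup.of 1, by simp⟩
  let e := MulEquiv.ofBijective _ ⟨hinj, hsurj⟩
  have e0 : e.symm (genA l) = FreeGroup.of 0 := by
    rw [MulEquiv.symm_apply_eq]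
    exact (by simp : FreeGroup.lift ![genA l, genB l] (FreeGroup.of 0) = genA l).symm
  have e1 : e.symm (genB l) = FreeGroup.of 1 := by
    rw [MulEquiv.symm_apply_eq]
    exact (by simp : FreeGroup.lift ![genA l, genB l] (FreeGroup.of 1) = genB l).symm
  exact ⟨(FreeGroup.lift ![x, y]).comp e.symm.toMonoidHom, by simp [e0], by simp [e1]⟩

end Hyperbolic

/-! ### The positivity criterion -/

section Positivity

variable {F : Type*} [Field F] [LinearOrder F] {l : Fin 3 → Line ℝ}

/-- The action on the projective line given by a representation. -/
abbrev repAction {Γ : Subgroup PSL(2, ℝ)} (ρ : Γ →* PSL(2, F)) : MulAction Γ (OnePoint F) :=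
  MulAction.compHom _ ρ

/-- A representation that plays ping-pong with the same cyclic configuration as the three-holed
sphere group is positive: the orbit maps of the two fixed points of `a` correspond to each other. -/
theorem isPositive_of_pingPong (hl : IsHyperbolicTriple l)
    (ρ : threeHoledSphereGroup l →* PSL(2, F)) {T : Fin 4 → Set (OnePoint F)} {q : OnePoint F}
    (hT : letI := repAction ρ; PingPong (genA l) (genB l) Cyc T q) : IsPositive ρ := by
  let := repAction ρ
  obtain ⟨C, S, p, hC, hS, hlim⟩ := exists_pingPong_of_isHyperbolicTriple hl
  have hG := closure_genA_genB l
  have hP := hS.prod hT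
  have circ : IsCircular C := by
    rcases hC with rfl | rfl
    · exact isCircular_cyc
    · exact isCircular_cyc.reverse
  have well : ∀ g g' : threeHoledSphereGroup l, g • p = g' • p → g • q = g' • q := by
    intro g g' h
    by_contra hne
    obtain ⟨z, hz | hz⟩ := hP.exists_order hG (g₁ := g) (g₂ := g')
      (fun e => hne (congrArg Prod.snd e))
    · exact circ.ne hz.1 h
    · exact circ.ne hz.1 h.symm
  have order : ∀ g₁ g₂ g₃ : threeHoledSphereGroup l, C (g₁ • p) (g₂ • p) (g₃ • p) →
      Cyc (g₁ • q) (g₂ • q) (g₃ • q) := by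
    intro g₁ g₂ g₃ h
    rcases hP.order_orbit hG (g₁ := g₁) (g₂ := g₂) (g₃ := g₃)
      (fun e => circ.ne h (congrArg Prod.fst e)) (fun e => circ.ne' h (congrArg Prod.fst e))
      (fun e => circ.ne'' h (congrArg Prod.fst e)) with h1 | h1
    · exact h1.2
    · exact absurd (circ.rot (circ.rot h1.1)) (circ.asymm h)
  classical
  let ξ : OnePoint ℝ → OnePoint F := fun x =>
    if h : ∃ g : threeHoledSphereGroup l, g • p = x then h.choose • q else ∞
  have hξ : ∀ g : threeHoledSphereGroup l, ξ (g • p) = g • q := by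
    intro g
    have h : ∃ g' : threeHoledSphereGroup l, g' • p = g • p := ⟨g, rfl⟩
    simp only [ξ, dif_pos h]
    exact well _ _ h.choose_spec
  refine ⟨{x | ∃ g : threeHoledSphereGroup l, g • p = x}, ?_, ⟨p, 1, one_smul _ _⟩, ?_, ξ, ?_, ?_⟩
  · rintro _ ⟨g, rfl⟩
    exact hlim g
  · rintro γ hγ _ ⟨g, rfl⟩
    exact ⟨⟨γ, hγ⟩ * g, mul_smul _ _ _⟩
  · rintro γ _ ⟨g, rfl⟩
    change ξ (γ • g • p) = γ • ξ (g • p)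
    rw [hξ, ← mul_smul, hξ, mul_smul]
  · intro n x hx hcyc
    choose g hg using hx
    have hcomp : ∀ i, (ξ ∘ x) i = g i • q := fun i => by rw [Function.comp_apply, ← hg, hξ]
    rcases hC with rfl | rfl
    · left
      intro i j k hij hjk
      rw [hcomp, hcomp, hcomp]
      apply order
      rw [hg, hg, hg]
      exact hcyc i j k hij hjk
    · right
      intro i j k hij hjk
      dsimp only
      rw [hcomp, hcomp, hcomp]
      apply order
      rw [hg, hg, hg]
      exact hcyc _ _ _ (Fin.rev_lt_rev.mpr hjk) (Fin.rev_lt_rev.mpr hij)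

/-- Sets as in the positivity criterion form a ping-pong system with the fixed point `p` as base
point. -/
theorem isPositive_of_table [IsStrictOrderedRing F] (hl : IsHyperbolicTriple l)
    (ρ : threeHoledSphereGroup l →* PSL(2, F))
    {p : OnePoint F} {U₁ U₂ V₁ V₂ : Set (OnePoint F)} (hfix : ρ (genA l) • p = p) (hp : p ∈ U₂)
    (hdis : [U₁, U₂, V₁, V₂].Pairwise Disjoint)
    (ha : ∀ q, q ∉ U₁ → ρ (genA l) • q ∈ U₂) (ha' : ∀ q, q ∉ U₂ → (ρ (genA l))⁻¹ • q ∈ U₁)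
    (hb : ∀ q, q ∉ V₁ → ρ (genB l) • q ∈ V₂) (hb' : ∀ q, q ∉ V₂ → (ρ (genB l))⁻¹ • q ∈ V₁)
    (hcyc : ∀ u₁ ∈ U₁, ∀ u₂ ∈ U₂, ∀ v₁ ∈ V₁, ∀ v₂ ∈ V₂, CycTuple ![u₁, u₂, v₁, v₂]) :
    IsPositive ρ := by
  let := repAction ρ
  simp only [List.pairwise_cons, List.mem_cons, List.not_mem_nil, or_false] at hdis
  obtain ⟨h1, h2, h3, -⟩ := hdis
  let T : Fin 4 → Set (OnePoint F) := ![U₁, U₂, V₁, V₂]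
  have hdisj : ∀ s t : Fin 4, s ≠ t → Disjoint (T s) (T t) := by
    have : ∀ s t : Fin 4, s < t → Disjoint (T s) (T t) := by
      intro s t hst
      fin_cases s <;> fin_cases t <;> simp at hst <;> simp [T, h1, h2, h3]
    intro s t hst
    rcases lt_or_gt_of_ne hst with h | h
    · exact this s t h
    · exact (this t s h).symm
  have hout : ∀ s, ∀ z ∉ T (invLetter s), letterElt (genA l) (genB l) s • z ∈ T s := by
    intro s z hz
    fin_cases s
    · change ρ (genA l)⁻¹ • z ∈ U₁
      rw [map_inv]
      exact ha' z hz
    · exact ha z hz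
    · change ρ (genB l)⁻¹ • z ∈ V₁
      rw [map_inv]
      exact hb' z hz
    · exact hb z hz
  have hmaps : ∀ s t, t ≠ invLetter s → ∀ z ∈ T t, letterElt (genA l) (genB l) s • z ∈ T s :=
    fun s t hst z hz => hout s z fun hz' => Set.disjoint_left.mp (hdisj _ _ hst) hz hz'
  -- none of the sets is empty, as they all contain images of the fixed point
  obtain ⟨v₁, hv₁⟩ : V₁.Nonempty := ⟨_, hmaps 2 1 (by decide) p hp⟩
  obtain ⟨v₂, hv₂⟩ : V₂.Nonempty := ⟨_, hmaps 3 1 (by decide) p hp⟩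
  obtain ⟨u₁, hu₁⟩ : U₁.Nonempty := ⟨_, hmaps 0 3 (by decide) v₂ hv₂⟩
  have main : ∀ s t u : Fin 4, s < t ∧ t < u → ∀ x ∈ T s, ∀ y ∈ T t, ∀ z ∈ T u, Cyc x y z := by
    intro s t u hs x hx y hy z hz
    have : ∀ s t u : Fin 4, s < t ∧ t < u → (s = 0 ∧ t = 1 ∧ u = 2) ∨ (s = 0 ∧ t = 1 ∧ u = 3) ∨
        (s = 0 ∧ t = 2 ∧ u = 3) ∨ (s = 1 ∧ t = 2 ∧ u = 3) := by decide
    rcases this s t u hs with ⟨rfl, rfl, rfl⟩ | ⟨rfl, rfl, rfl⟩ | ⟨rfl, rfl, rfl⟩ | ⟨rfl, rfl, rfl⟩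
    · exact hcyc x hx y hy z hz v₂ hv₂ 0 1 2 (by decide) (by decide)
    · exact hcyc x hx y hy v₁ hv₁ z hz 0 1 3 (by decide) (by decide)
    · exact hcyc x hx p hp y hy z hz 0 2 3 (by decide) (by decide)
    · exact hcyc u₁ hu₁ x hx y hy z hz 1 2 3 (by decide) (by decide)
  refine isPositive_of_pingPong hl ρ (T := T) (q := p) ⟨hmaps, hp, hfix, fun x y z h => h.rot,
    fun g x y z h => (cyc_psl_smul_iff (ρ g) x y z).mpr h, ?_⟩
  intro s t u hs x hx y hy z hz
  rcases hs with hs | hs | hs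
  · exact main _ _ _ hs _ hx _ hy _ hz
  · exact (main _ _ _ hs _ hy _ hz _ hx).rot.rot
  · exact (main _ _ _ hs _ hz _ hx _ hy).rot

theorem IsAttractingFixedPoint.smul_eq {g : PSL(2, F)} {p : OnePoint F}
    (h : IsAttractingFixedPoint g p) : g • p = p := by
  obtain ⟨A, t, rfl, -, hA⟩ := h
  exact smul_eq_of_mulVec_eq (g := Matrix.SpecialLinearGroup.toGL A) hA

/-- A framing would map the fixed point of `c` to a fixed point of `ρ(c)`. -/
theorem not_isFraming {ρ : threeHoledSphereGroup l →* PSL(2, F)}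
    (hc : IsParabolicElement (genC l : PSL(2, ℝ))) (hρ : ∀ q : OnePoint F, ρ (genC l) • q ≠ q)
    (ξ : OnePoint ℝ → OnePoint F) : ¬ IsFraming ρ ξ := by
  intro h
  obtain ⟨x, hx, -⟩ := id hc
  have := h (genC l) x ⟨_, (genC l).2, hc, hx⟩
  rw [hx] at this
  exact hρ _ this.symm

end Positivity

/-! ### Crossing triples over non-Archimedean fields -/

section Infinitesimal

variable {F : Type*} [Field F] [LinearOrder F] [IsStrictOrderedRing F]

theorem isInfinitesimal_zero : IsInfinitesimal (0 : F) := fun n => by simp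

theorem IsInfinitesimal.of_abs_le {s t : F} (ht : IsInfinitesimal t) (k : ℕ)
    (h : |s| ≤ k * |t|) : IsInfinitesimal s := fun n =>
  calc (n : F) * |s| ≤ n * (k * |t|) := mul_le_mul_of_nonneg_left h (Nat.cast_nonneg n)
    _ = ((n * k : ℕ) : F) * |t| := by push_cast; ring
    _ < 1 := ht _

theorem IsInfinitesimal.add {s t : F} (hs : IsInfinitesimal s) (ht : IsInfinitesimal t) :
    IsInfinitesimal (s + t) := by
  intro n
  have h1 := hs (2 * n)
  have h2 := ht (2 * n)
  have h3 := mul_le_mul_of_nonneg_left (abs_add_le s t) (Nat.cast_nonneg (α := F) n)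
  push_cast at h1 h2
  linarith

theorem IsInfinitesimal.abs_lt_inv {t : F} (ht : IsInfinitesimal t) : |t| < 1 / 4 := by
  have := ht 4
  push_cast at this
  linarith

theorem not_isInfinitesimal_of_half_le {t : F} (h : 1 / 2 ≤ t) : ¬ IsInfinitesimal t := by
  intro ht
  have := ht.abs_lt_inv
  linarith [le_abs_self t]

end Infinitesimal

section Normalized

variable {F : Type*} [Field F]

theorem Line.reflGL_smul_coe_of_zero_one [DecidableEq F] {l : Line F}
    (hx : l.x = ((0 : F) : OnePoint F)) (hy : l.y = ((1 : F) : OnePoint F)) {z : F}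
    (hz : 2 * z - 1 ≠ 0) : l.reflGL • (z : OnePoint F) = ((z / (2 * z - 1) : F) : OnePoint F) := by
  refine smul_eq_of_mulVec_eq (c := 1 - 2 * z) ?_
  rw [l.coe_reflGL]
  ext i
  fin_cases i
  · simp [Line.refl, hx, hy, homog, det2]
    linear_combination div_mul_cancel₀ z hz
  · simp [Line.refl, hx, hy, homog, det2]
    ring

theorem Line.reflGL_smul_infty_of_zero_one [DecidableEq F] [NeZero (2 : F)] {l : Line F}
    (hx : l.x = ((0 : F) : OnePoint F)) (hy : l.y = ((1 : F) : OnePoint F)) :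
    l.reflGL • (∞ : OnePoint F) = ((1 / 2 : F) : OnePoint F) := by
  refine smul_eq_of_mulVec_eq (c := -2) ?_
  rw [l.coe_reflGL]
  ext i
  fin_cases i
  · simp [Line.refl, hx, hy, homog, det2]
    exact (mul_inv_cancel₀ two_ne_zero).symm
  · simp [Line.refl, hx, hy, homog, det2]

theorem Line.reflGL_smul_coe_of_infty [DecidableEq F] {l : Line F} {t : F} (hx : l.x = ∞)
    (hy : l.y = (t : OnePoint F)) (z : F) :
    l.reflGL • (z : OnePoint F) = ((2 * t - z : F) : OnePoint F) := by
  refine smul_eq_of_mulVec_eq (c := -1) ?_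
  rw [l.coe_reflGL]
  ext i
  fin_cases i
  · simp [Line.refl, hx, hy, homog, det2]
    ring
  · simp [Line.refl, hx, hy, homog, det2]

variable [LinearOrder F]

/-- The points infinitesimally close to `1`. -/
def halo (F : Type*) [Field F] [LinearOrder F] : Set (OnePoint F) :=
  {p | ∃ z : F, p = z ∧ IsInfinitesimal (1 - z)}

/-- The points of `[0, 1)` that are not infinitesimally close to `1`. -/
def leftPart (F : Type*) [Field F] [LinearOrder F] : Set (OnePoint F) :=
  {p | ∃ z : F, p = z ∧ 0 ≤ z ∧ z < 1 ∧ ¬ IsInfinitesimal (1 - z)}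

/-- The points of `(1, ∞]` that are not infinitesimally close to `1`. -/
def rightPart (F : Type*) [Field F] [LinearOrder F] : Set (OnePoint F) :=
  {p | p = ∞ ∨ ∃ z : F, p = z ∧ 1 < z ∧ ¬ IsInfinitesimal (1 - z)}

variable [IsStrictOrderedRing F]

theorem reflGL_smul_mem_halo_of_zero_one {l : Line F} (hx : l.x = ((0 : F) : OnePoint F))
    (hy : l.y = ((1 : F) : OnePoint F)) {p : OnePoint F} (hp : p ∈ halo F) :
    l.reflGL • p ∈ halo F := by
  obtain ⟨z, rfl, hz⟩ := hp
  have h1 := abs_lt.mp hz.abs_lt_inv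
  have h2 : 1 / 2 < 2 * z - 1 := by linarith
  refine ⟨_, l.reflGL_smul_coe_of_zero_one hx hy (by linarith : 0 < 2 * z - 1).ne', ?_⟩
  refine hz.of_abs_le 2 ?_
  have h3 : 1 - z / (2 * z - 1) = -(1 - z) / (2 * z - 1) := by
    have : 2 * z - 1 ≠ 0 := by linarith
    rw [eq_div_iff this, sub_mul, div_mul_cancel₀ _ this]
    ring
  rw [h3, abs_div, abs_neg, abs_of_pos (by linarith : 0 < 2 * z - 1), div_le_iff₀ (by linarith)]
  push_cast
  nlinarith [abs_nonneg (1 - z)]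

theorem reflGL_smul_mem_leftPart {l : Line F} (hx : l.x = ((0 : F) : OnePoint F))
    (hy : l.y = ((1 : F) : OnePoint F)) {p : OnePoint F} (hp : p ∉ leftPart F) (hp' : p ∉ halo F) :
    l.reflGL • p ∈ leftPart F := by
  induction p using OnePoint.rec with
  | infty =>
    refine ⟨_, l.reflGL_smul_infty_of_zero_one hx hy, by norm_num, by norm_num,
      not_isInfinitesimal_of_half_le (by norm_num)⟩
  | coe z =>
    have hinf : ¬ IsInfinitesimal (1 - z) := fun h => hp' ⟨z, rfl, h⟩
    have hz : z < 0 ∨ 1 < z := by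
      by_contra! h
      rcases h.2.lt_or_eq with h2 | h2
      · exact hp ⟨z, rfl, h.1, h2, hinf⟩
      · exact hinf (by rw [h2, sub_self]; exact isInfinitesimal_zero)
    rcases hz with hz | hz
    · have h1 : 2 * z - 1 < 0 := by linarith
      refine ⟨_, l.reflGL_smul_coe_of_zero_one hx hy h1.ne, div_nonneg_of_nonpos hz.le h1.le, ?_,
        not_isInfinitesimal_of_half_le ?_⟩
      · rw [div_lt_one_of_neg h1]; linarith
      · have : z / (2 * z - 1) ≤ 1 / 2 := by
          rw [div_le_iff_of_neg h1]; linarith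
        linarith
    · have h1 : 0 < 2 * z - 1 := by linarith
      refine ⟨_, l.reflGL_smul_coe_of_zero_one hx hy h1.ne', div_nonneg (by linarith) h1.le, ?_, ?_⟩
      · rw [div_lt_one h1]; linarith
      · have h3 : 1 - z / (2 * z - 1) = (z - 1) / (2 * z - 1) := by
          rw [eq_div_iff h1.ne', sub_mul, div_mul_cancel₀ _ h1.ne']
          ring
        rw [h3]
        -- the distance to `1` shrinks at most by the factor `3` for `z ≤ 2`, and is at least
        -- `1 / 3` for `z ≥ 2`
        rcases le_total z 2 with h2 | h2
        · intro h4
          refine hinf (h4.of_abs_le 3 ?_)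
          rw [abs_div, abs_of_pos h1, abs_sub_comm z 1, mul_div_assoc', le_div_iff₀ h1]
          push_cast
          nlinarith [abs_nonneg (1 - z)]
        · intro h4
          have h5 := h4.abs_lt_inv
          have h6 : 1 / 3 ≤ (z - 1) / (2 * z - 1) := by
            rw [div_le_div_iff₀ (by norm_num) h1]; linarith
          linarith [le_abs_self ((z - 1) / (2 * z - 1))]

theorem reflGL_smul_mem_halo_of_infty {l : Line F} {t : F} (hx : l.x = ∞)
    (hy : l.y = (t : OnePoint F)) (ht : IsInfinitesimal (1 - t)) {p : OnePoint F}
    (hp : p ∈ halo F) :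
    l.reflGL • p ∈ halo F := by
  obtain ⟨z, rfl, hz⟩ := hp
  refine ⟨_, l.reflGL_smul_coe_of_infty hx hy z, ?_⟩
  have h1 : IsInfinitesimal (-(1 - z)) := hz.of_abs_le 1 (by rw [abs_neg]; simp)
  have := (ht.add ht).add h1
  rwa [show 1 - t + (1 - t) + -(1 - z) = 1 - (2 * t - z) by ring] at this

theorem reflGL_smul_mem_rightPart {l : Line F} {t : F} (hx : l.x = ∞) (hy : l.y = (t : OnePoint F))
    (ht1 : t < 1) (ht : IsInfinitesimal (1 - t)) {p : OnePoint F} (hp : p ∉ rightPart F)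
    (hp' : p ∉ halo F) : l.reflGL • p ∈ rightPart F := by
  induction p using OnePoint.rec with
  | infty => exact absurd (Or.inl rfl) hp
  | coe z =>
    have hinf : ¬ IsInfinitesimal (1 - z) := fun h => hp' ⟨z, rfl, h⟩
    have hz : z < 1 := by
      by_contra! h
      rcases h.lt_or_eq with h2 | h2
      · exact hp (Or.inr ⟨z, rfl, h2, hinf⟩)
      · exact hinf (by rw [← h2, sub_self]; exact isInfinitesimal_zero)
    refine Or.inr ⟨_, l.reflGL_smul_coe_of_infty hx hy z, ?_, ?_⟩
    · by_contra! h
      refine hinf (ht.of_abs_le 2 ?_)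
      rw [abs_of_pos (by linarith), abs_of_pos (by linarith)]
      push_cast
      linarith
    · intro h
      have h1 : IsInfinitesimal (-(1 - (2 * t - z))) := h.of_abs_le 1 (by rw [abs_neg]; simp)
      have := (ht.add ht).add h1
      rw [show 1 - t + (1 - t) + -(1 - (2 * t - z)) = 1 - z by ring] at this
      exact hinf this

/-- The mirror system of a crossing triple with `x₁ = 0`, `y₁ = 1` and `x₃ = ∞`. The points
infinitesimally close to `1` are mapped to each other by the first and the third reflection; they
are added to the interval of the first line on one side of the configuration, and to the interval
of the third line on the other side. -/
theorem mirrorSystem_of_normalized {l : Fin 3 → Line F} {t x y : F}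
    (h0x : (l 0).x = ((0 : F) : OnePoint F)) (h0y : (l 0).y = ((1 : F) : OnePoint F))
    (h2x : (l 2).x = ∞) (h2y : (l 2).y = (t : OnePoint F)) (ht1 : t < 1)
    (ht : IsInfinitesimal (1 - t)) (h1x : (l 1).x = (x : OnePoint F))
    (h1y : (l 1).y = (y : OnePoint F)) (hyx : y < x) (hx : x < 0) :
    MirrorSystem Cyc ((l 0).reflGL • ·) ((l 1).reflGL • ·) ((l 2).reflGL • ·)
      (leftPart F) (leftPart F ∪ halo F) (rightPart F ∪ halo F) (rightPart F)
      {w | w = (l 1).x ∨ w = (l 1).y ∨ Cyc (l 1).y w (l 1).x}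
      {w | w = (l 1).x ∨ w = (l 1).y ∨ Cyc (l 1).y w (l 1).x} := by
  have hR : ∀ w : OnePoint F, (w = (l 1).x ∨ w = (l 1).y ∨ Cyc (l 1).y w (l 1).x) →
      ∃ r : F, w = r ∧ r < 0 := by
    intro w hw
    rw [h1x, h1y] at hw
    rcases hw with rfl | rfl | hw
    · exact ⟨x, rfl, hx⟩
    · exact ⟨y, rfl, hyx.trans hx⟩
    · induction w using OnePoint.rec with
      | infty =>
        have : x < y := by simpa [Cyc, ltTop] using hw
        exact absurd hyx this.not_gt
      | coe r =>
        refine ⟨r, rfl, ?_⟩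
        rcases hw with ⟨h1, h2⟩ | ⟨h1, h2⟩ | ⟨h1, h2⟩ <;> simp only [ltTop] at h1 h2 <;> linarith
  have hcyc : ∀ {a : F} {q r : OnePoint F}, 0 ≤ a → (q = ∞ ∨ ∃ b : F, q = b ∧ a < b) →
      (r = (l 1).x ∨ r = (l 1).y ∨ Cyc (l 1).y r (l 1).x) → Cyc (a : OnePoint F) q r := by
    intro a q r ha hq hr
    obtain ⟨r, rfl, hr0⟩ := hR r hr
    rcases hq with rfl | ⟨b, rfl, hb⟩
    · exact Or.inr (Or.inr ⟨hr0.trans_le ha, trivial⟩)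
    · exact Or.inr (Or.inr ⟨hr0.trans_le ha, hb⟩)
  have hlr : ∀ {p q : OnePoint F}, p ∈ leftPart F ∪ halo F → q ∈ rightPart F →
      ∃ a : F, p = a ∧ 0 ≤ a ∧ (q = ∞ ∨ ∃ b : F, q = b ∧ a < b) := by
    rintro p q (⟨a, rfl, ha0, ha1, -⟩ | ⟨a, rfl, ha⟩) hq
    · refine ⟨a, rfl, ha0, hq.imp_right ?_⟩
      rintro ⟨b, rfl, hb, -⟩
      exact ⟨b, rfl, ha1.trans hb⟩
    · refine ⟨a, rfl, by linarith [(abs_lt.mp ha.abs_lt_inv).2], hq.imp_right ?_⟩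
      rintro ⟨b, rfl, hb, hb'⟩
      refine ⟨b, rfl, ?_⟩
      by_contra! h
      refine hb' (ha.of_abs_le 1 ?_)
      rw [abs_of_neg (by linarith), abs_of_neg (by linarith)]
      push_cast
      linarith
  have hout : ∀ p : OnePoint F, ¬ (p = (l 1).x ∨ p = (l 1).y ∨ Cyc (l 1).y p (l 1).x) →
      ((l 1).reflGL • p = (l 1).x ∨ (l 1).reflGL • p = (l 1).y ∨
        Cyc (l 1).y ((l 1).reflGL • p) (l 1).x) := by
    intro p hp
    push Not at hp
    have h1 : Cyc (l 1).x p (l 1).y :=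
      (cyc_total hp.1.symm hp.2.1 (l 1).ne.symm).resolve_right hp.2.2
    have h2 := ((l 1).cyc_reflGL_smul_iff (l 1).y p (l 1).x).mpr h1
    rw [(l 1).reflGL_smul_x, (l 1).reflGL_smul_y] at h2
    exact Or.inr (Or.inr h2)
  have hzero : ((0 : F) : OnePoint F) ∈ leftPart F :=
    ⟨0, rfl, le_rfl, one_pos, not_isInfinitesimal_of_half_le (by norm_num)⟩
  refine ⟨isCircular_cyc, (l 1).reflGL_smul_reflGL_smul,
    fun x y z h => ((l 1).cyc_reflGL_smul_iff x y z).mpr h, ?_, ?_, hout, hout, ?_, ?_, ?_, ?_,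
    ⟨_, hzero⟩, ⟨_, Or.inl hzero⟩, ⟨∞, Or.inl (Or.inl rfl)⟩, ⟨∞, Or.inl rfl⟩⟩
  · intro p hp
    by_cases hp' : p ∈ halo F
    · exact Or.inr (reflGL_smul_mem_halo_of_zero_one h0x h0y hp')
    · exact Or.inl (reflGL_smul_mem_leftPart h0x h0y hp hp')
  · intro p hp
    exact reflGL_smul_mem_leftPart h0x h0y (fun h => hp (Or.inl h)) fun h => hp (Or.inr h)
  · intro p hp
    exact reflGL_smul_mem_rightPart h2x h2y ht1 ht (fun h => hp (Or.inl h)) fun h => hp (Or.inr h)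
  · intro p hp
    by_cases hp' : p ∈ halo F
    · exact Or.inr (reflGL_smul_mem_halo_of_infty h2x h2y ht hp')
    · exact Or.inl (reflGL_smul_mem_rightPart h2x h2y ht1 ht hp hp')
  · rintro p hp q (hq | ⟨b, rfl, hb⟩) r hr
    · obtain ⟨a, rfl, ha, h⟩ := hlr (Or.inl hp) hq
      exact hcyc ha h hr
    · obtain ⟨a, rfl, ha0, ha1, ha⟩ := hp
      refine hcyc ha0 (Or.inr ⟨b, rfl, ?_⟩) hr
      by_contra! h
      refine ha (hb.of_abs_le 1 ?_)
      rw [abs_of_pos (by linarith), abs_of_pos (by linarith)]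
      push_cast
      linarith
  · intro p hp q hq r hr
    obtain ⟨a, rfl, ha, h⟩ := hlr hp hq
    exact hcyc ha h hr

end Normalized

section Crossing

theorem MirrorSystem.comap {X Y : Type*} {C : X → X → X → Prop} {D : Y → Y → Y → Prop}
    {r₀ r₁ r₂ : X → X} {s₀ s₁ s₂ : Y → Y} {P P' Q Q' R R' : Set Y}
    (h : MirrorSystem D s₀ s₁ s₂ P P' Q Q' R R') (hC : IsCircular C) (f : X → Y)
    (hf : Function.Surjective f) (hinvol : ∀ x, r₁ (r₁ x) = x)
    (hrev : ∀ x y z, C z y x → C (r₁ x) (r₁ y) (r₁ z))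
    (hCD : ∀ x y z, D (f x) (f y) (f z) → C x y z) (h₀ : ∀ x, f (r₀ x) = s₀ (f x))
    (h₁ : ∀ x, f (r₁ x) = s₁ (f x)) (h₂ : ∀ x, f (r₂ x) = s₂ (f x)) :
    MirrorSystem C r₀ r₁ r₂ (f ⁻¹' P) (f ⁻¹' P') (f ⁻¹' Q) (f ⁻¹' Q') (f ⁻¹' R) (f ⁻¹' R') where
  circ := hC
  invol := hinvol
  rev := hrev
  out₀ x hx := by rw [Set.mem_preimage, h₀]; exact h.out₀ _ hx
  out₀' x hx := by rw [Set.mem_preimage, h₀]; exact h.out₀' _ hx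
  out₁ x hx := by rw [Set.mem_preimage, h₁]; exact h.out₁ _ hx
  out₁' x hx := by rw [Set.mem_preimage, h₁]; exact h.out₁' _ hx
  out₂ x hx := by rw [Set.mem_preimage, h₂]; exact h.out₂ _ hx
  out₂' x hx := by rw [Set.mem_preimage, h₂]; exact h.out₂' _ hx
  cyc x hx y hy z hz := hCD _ _ _ (h.cyc _ hx _ hy _ hz)
  cyc' x hx y hy z hz := hCD _ _ _ (h.cyc' _ hx _ hy _ hz)
  nonempty₀ := h.nonempty₀.preimage hf
  nonempty₀' := h.nonempty₀'.preimage hf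
  nonempty₂ := h.nonempty₂.preimage hf
  nonempty₂' := h.nonempty₂'.preimage hf

variable {F : Type*} [Field F] [LinearOrder F] [IsStrictOrderedRing F]

theorem crossRatio_smul (g : GL (Fin 2) F) (x y z w : OnePoint F) :
    crossRatio (g • x) (g • y) (g • z) (g • w) = crossRatio x y z w := by
  obtain ⟨a, ha, hx⟩ := exists_mulVec_homog g x
  obtain ⟨b, hb, hy⟩ := exists_mulVec_homog g y
  obtain ⟨c, hc, hz⟩ := exists_mulVec_homog g z
  obtain ⟨d, hd, hw⟩ := exists_mulVec_homog g w
  have hg : g.1.det ≠ 0 := g.det_ne_zero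
  have e1 := det2_smul g x z hx hz
  have e2 := det2_smul g y w hy hw
  have e3 := det2_smul g x y hx hy
  have e4 := det2_smul g z w hz hw
  have hk : a * b * c * d ≠ 0 := by positivity
  have hg2 : g.1.det * g.1.det ≠ 0 := mul_ne_zero hg hg
  have hn : a * b * c * d * (det2 (g • x) (g • z) * det2 (g • y) (g • w)) =
      g.1.det * g.1.det * (det2 x z * det2 y w) := by
    calc _ = (a * c * det2 (g • x) (g • z)) * (b * d * det2 (g • y) (g • w)) := by ring
      _ = _ := by rw [e1, e2]; ring
  have hd : a * b * c * d * (det2 (g • x) (g • y) * det2 (g • z) (g • w)) =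
      g.1.det * g.1.det * (det2 x y * det2 z w) := by
    calc _ = (a * b * det2 (g • x) (g • y)) * (c * d * det2 (g • z) (g • w)) := by ring
      _ = _ := by rw [e3, e4]; ring
  rw [crossRatio, crossRatio, ← mul_div_mul_left _ _ hk, hn, hd, mul_div_mul_left _ _ hg2]

/-- Cyclically ordered triples can be moved to `0, 1, ∞` without changing the orientation. -/
theorem exists_smul_eq_zero_one_infty {x y z : OnePoint F} (h : Cyc x y z) :
    ∃ g : GL (Fin 2) F, 0 < g.1.det ∧ g • x = ((0 : F) : OnePoint F) ∧
      g • y = ((1 : F) : OnePoint F) ∧ g • z = ∞ := by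
  let M : Matrix (Fin 2) (Fin 2) F :=
    !![-(det2 z y * homog x 1), det2 z y * homog x 0;
       -(det2 x y * homog z 1), det2 x y * homog z 0]
  have hM : M.det = det2 x y * det2 y z * det2 z x := by
    simp only [M, Matrix.det_fin_two_of, det2]
    ring
  have hpos : 0 < M.det := by rw [hM]; exact (cyc_iff x y z).mp h
  refine ⟨Matrix.GeneralLinearGroup.mkOfDetNeZero M hpos.ne', hpos, ?_, ?_, ?_⟩
  · refine smul_eq_of_mulVec_eq (c := det2 x y * det2 z x) ?_
    ext i
    fin_cases i
    · simp [Matrix.GeneralLinearGroup.mkOfDetNeZero, M, homog_coe, -Matrix.cons_mulVec,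
        Matrix.mulVec, dotProduct, Fin.sum_univ_two]
      ring
    · simp [Matrix.GeneralLinearGroup.mkOfDetNeZero, M, homog_coe, det2, -Matrix.cons_mulVec,
        Matrix.mulVec, dotProduct, Fin.sum_univ_two]
      ring
  · refine smul_eq_of_mulVec_eq (c := det2 z y * det2 x y) ?_
    ext i
    fin_cases i
    · simp [Matrix.GeneralLinearGroup.mkOfDetNeZero, M, homog_coe, det2, -Matrix.cons_mulVec,
        Matrix.mulVec, dotProduct, Fin.sum_univ_two]
      ring
    · simp [Matrix.GeneralLinearGroup.mkOfDetNeZero, M, homog_coe, det2, -Matrix.cons_mulVec,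
        Matrix.mulVec, dotProduct, Fin.sum_univ_two]
      ring
  · refine smul_eq_of_mulVec_eq (c := det2 z y * det2 x z) ?_
    ext i
    fin_cases i
    · simp [Matrix.GeneralLinearGroup.mkOfDetNeZero, M, homog_infty, det2, -Matrix.cons_mulVec,
        Matrix.mulVec, dotProduct, Fin.sum_univ_two]
      ring
    · simp [Matrix.GeneralLinearGroup.mkOfDetNeZero, M, homog_infty, -Matrix.cons_mulVec,
        Matrix.mulVec, dotProduct, Fin.sum_univ_two]
      ring

/-- Mirror systems of crossing triples, pulled back from the normalized position. -/
theorem exists_mirrorSystem_of_isCrossingTriple {m : Fin 3 → Line F} (hm : IsCrossingTriple m) :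
    ∃ P P' Q Q' R : Set (OnePoint F),
      MirrorSystem Cyc ((m 0).reflGL • ·) ((m 1).reflGL • ·) ((m 2).reflGL • ·) P P' Q Q' R R := by
  obtain ⟨hcyc, hneg, hinf⟩ := hm
  have c023 : Cyc (m 0).x (m 0).y (m 2).x := hcyc 0 2 3 (by decide) (by decide)
  have c345 : Cyc (m 2).x (m 1).y (m 1).x := hcyc 3 4 5 (by decide) (by decide)
  have c035 : Cyc (m 0).x (m 2).x (m 1).x := hcyc 0 3 5 (by decide) (by decide)
  obtain ⟨g, hg, h0x, h0y, h2x⟩ := exists_smul_eq_zero_one_infty c023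
  have hinj := MulAction.injective (β := OnePoint F) g
  have coe : ∀ p : OnePoint F, p ≠ ∞ → ∃ z : F, p = z := fun p hp =>
    (OnePoint.ne_infty_iff_exists.mp hp).imp fun _ h => h.symm
  obtain ⟨t, h2y⟩ := coe (g • (m 2).y) fun h => (m 2).ne (hinj (h2x.trans h.symm))
  rw [← cyc_smul_iff hg, h2x] at c345
  rw [← cyc_smul_iff hg, h2x, h0x] at c035
  obtain ⟨y, h1y⟩ := coe (g • (m 1).y) fun h => c345.ne h.symm
  obtain ⟨x, h1x⟩ := coe (g • (m 1).x) fun h => c345.ne'' h.symm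
  have hyx : y < x := by simpa [h1y, h1x, Cyc, ltTop] using c345
  have hx : x < 0 := by simpa [h1x, Cyc, ltTop] using c035
  rw [← crossRatio_smul g, h0x, h0y, h2x, h2y] at hneg hinf
  have ht : crossRatio ((0 : F) : OnePoint F) ((1 : F) : OnePoint F) (t : OnePoint F) ∞ = t := by
    simp [crossRatio, det2, homog]
  rw [ht] at hneg hinf
  let l : Fin 3 → Line F := fun i => ⟨g • (m i).x, g • (m i).y, hinj.ne (m i).ne⟩
  have hl : MirrorSystem Cyc ((l 0).reflGL • ·) ((l 1).reflGL • ·) ((l 2).reflGL • ·) _ _ _ _ _ _ :=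
    mirrorSystem_of_normalized (l := l) h0x h0y h2x h2y (by linarith)
      (hinf.of_abs_le 1 (by rw [abs_sub_comm]; simp)) h1x h1y hyx hx
  have heq : ∀ i (p : OnePoint F), g • (m i).reflGL • p = (l i).reflGL • g • p := fun i p =>
    (Line.reflGL_smul_of_smul_eq g (m i) (l i) rfl rfl p).symm
  exact ⟨_, _, _, _, _, hl.comap isCircular_cyc (g • ·) (MulAction.surjective g)
    (m 1).reflGL_smul_reflGL_smul (fun x y z h => ((m 1).cyc_reflGL_smul_iff x y z).mpr h)
    (fun x y z => (cyc_smul_iff hg x y z).mp) (heq 0) (heq 1) (heq 2)⟩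

/-- The representation defined by a crossing triple is positive. -/
theorem isPositive_of_isCrossingTriple (hsq : ∀ x : F, 0 ≤ x → IsSquare x) {l : Fin 3 → Line ℝ}
    (hl : IsHyperbolicTriple l) {m : Fin 3 → Line F} (hm : IsCrossingTriple m)
    (ρ : threeHoledSphereGroup l →* PSL(2, F)) (ha : ρ (genA l) = (m 0).reflMul (m 1))
    (hb : ρ (genB l) = (m 1).reflMul (m 2)) : IsPositive ρ := by
  let := repAction ρ
  obtain ⟨P, P', Q, Q', R, hM⟩ := exists_mirrorSystem_of_isCrossingTriple hm
  have c025 : Cyc (m 0).x (m 0).y (m 1).x := hm.1 0 2 5 (by decide) (by decide)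
  have c024 : Cyc (m 0).x (m 0).y (m 1).y := hm.1 0 2 4 (by decide) (by decide)
  obtain ⟨p₀, hp₀⟩ := (m 0).exists_reflGL_smul_eq hsq (m 1) (fun h => c025.asymm h.rot)
    (fun h => c024.asymm h.rot)
  obtain ⟨p, hp, hmem⟩ : ∃ p, (m 0).reflGL • p = (m 1).reflGL • p ∧ p ∈ P := by
    by_cases h : p₀ ∈ P
    · exact ⟨p₀, hp₀, h⟩
    refine ⟨(m 0).reflGL • p₀, ?_, ?_⟩
    · rw [Line.reflGL_smul_reflGL_smul, hp₀, Line.reflGL_smul_reflGL_smul]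
    · -- otherwise `P'` contains two points that the second reflection exchanges, although it maps
      -- `P'` into the disjoint set `R`
      by_contra h'
      have h1 : (m 0).reflGL • p₀ ∈ P' := hM.out₀ _ h
      have h2 : p₀ ∈ P' := by
        have := hM.out₀ _ h'
        rwa [Line.reflGL_smul_reflGL_smul] at this
      have h3 : (m 1).reflGL • p₀ ∈ R := hM.symm.mem_R'_of_P h2
      obtain ⟨y, hy⟩ := hM.nonempty₂'
      rw [← hp₀] at h3
      exact (hM.cyc' _ h1 _ hy _ h3).ne'' rfl
  have ha₁ : ∀ x : OnePoint F, genA l • x = (m 0).reflGL • (m 1).reflGL • x := fun x => by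
    change ρ (genA l) • x = _
    rw [ha, Line.reflMul_smul]
  have hb₁ : ∀ x : OnePoint F, genB l • x = (m 1).reflGL • (m 2).reflGL • x := fun x => by
    change ρ (genB l) • x = _
    rw [hb, Line.reflMul_smul]
  refine isPositive_of_pingPong hl ρ (hM.pingPong ha₁ (fun x => ?_) hb₁ (fun x => ?_)
    (fun g x y z h => (cyc_psl_smul_iff (ρ g) x y z).mpr h) hmem ?_)
  · rw [inv_smul_eq_iff, ha₁, Line.reflGL_smul_reflGL_smul, Line.reflGL_smul_reflGL_smul]
  · rw [inv_smul_eq_iff, hb₁, Line.reflGL_smul_reflGL_smul, Line.reflGL_smul_reflGL_smul]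
  · rw [ha₁, ← hp, Line.reflGL_smul_reflGL_smul]

theorem abs_trace_of_isCrossingTriple {m : Fin 3 → Line F} (hm : IsCrossingTriple m) :
    |((m 2).refl * (m 0).refl).trace| =
      2 + 4 * (crossRatio (m 0).x (m 0).y (m 2).y (m 2).x - 1) := by
  have h := abs_lt.mp hm.2.2.abs_lt_inv
  rw [Line.trace_refl_mul_refl_eq_crossRatio, abs_of_pos (by linarith)]
  ring

theorem isInfinitesimalRotation_of_isCrossingTriple {m : Fin 3 → Line F} (hm : IsCrossingTriple m) :
    IsInfinitesimalRotation ((m 2).reflMul (m 0)) := by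
  refine ⟨(m 2).reflMulSL (m 0), rfl, ?_, ?_⟩
  · change |((m 2).refl * (m 0).refl).trace| < 2
    rw [abs_trace_of_isCrossingTriple hm]
    linarith [hm.2.1]
  · change IsInfinitesimal (2 - |((m 2).refl * (m 0).refl).trace|)
    rw [abs_trace_of_isCrossingTriple hm]
    refine hm.2.2.of_abs_le 4 (le_of_eq ?_)
    rw [show ∀ x : F, 2 - (2 + 4 * x) = -(4 * x) by intro x; ring, abs_neg, abs_mul]
    norm_num

theorem IsInfinitesimalRotation.smul_ne {g : PSL(2, F)} (hg : IsInfinitesimalRotation g)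
    (q : OnePoint F) : g • q ≠ q := by
  obtain ⟨A, rfl, hA, -⟩ := hg
  rw [mk_smul]
  refine Matrix.GeneralLinearGroup.IsElliptic.smul_ne_self ?_ q
  change A.1.discr < 0
  rw [Matrix.discr_fin_two, A.2]
  have := (sq_lt_sq₀ (abs_nonneg _) zero_le_two).mpr hA
  rw [sq_abs] at this
  linarith

theorem map_genC {H : Type*} [Group H] {l : Fin 3 → Line ℝ} (ρ : threeHoledSphereGroup l →* H) :
    ρ (genC l) = (ρ (genB l))⁻¹ * (ρ (genA l))⁻¹ := by
  rw [genC, map_mul, map_inv, map_inv]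

theorem exists_isCrossingTriple (hF : ¬ Archimedean F) :
    ∃ m : Fin 3 → Line F, IsCrossingTriple m := by
  rw [archimedean_iff_nat_lt] at hF
  push Not at hF
  obtain ⟨x, hx⟩ := hF
  have hx1 : 1 ≤ x := by simpa using hx 1
  set ε : F := 1 / (x + 1) with hε
  have hpos : 0 < ε := by positivity
  have hinf : IsInfinitesimal ε := by
    intro n
    rw [abs_of_pos hpos, hε, mul_one_div, div_lt_one (by linarith)]
    linarith [hx n]
  have hlt : ε < 1 := by linarith [hinf.abs_lt_inv, le_abs_self ε]
  have hCR : crossRatio ((0 : F) : OnePoint F) ((1 : F) : OnePoint F)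
      ((1 - ε : F) : OnePoint F) ∞ - 1 = -ε := by
    simp [crossRatio, det2, homog]
  refine ⟨![⟨((0 : F) : OnePoint F), ((1 : F) : OnePoint F), by simp⟩,
    ⟨((-1 : F) : OnePoint F), ((-2 : F) : OnePoint F), by
      rw [Ne, OnePoint.coe_eq_coe]; intro h; linarith⟩,
    ⟨∞, ((1 - ε : F) : OnePoint F), OnePoint.infty_ne_coe _⟩], ?_, ?_, ?_⟩
  · have h1 : (0 : F) < 1 - ε := by linarith
    have h2 : 1 - ε < (1 : F) := by linarith
    have h3 : (-2 : F) < -1 := by linarith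
    have h4 : (-2 : F) < 0 := by linarith
    have h5 : (-1 : F) < 0 := by linarith
    have h6 : (-2 : F) < 1 := by linarith
    have h7 : (-1 : F) < 1 := by linarith
    have h8 : (-2 : F) < 1 - ε := by linarith
    have h9 : (-1 : F) < 1 - ε := by linarith
    intro i j k hij hjk
    fin_cases i <;> fin_cases j <;> first
      | exact absurd hij (by decide)
      | (fin_cases k <;> first
          | exact absurd hjk (by decide)
          | exact Or.inl ⟨by first | trivial | assumption | exact one_pos,
              by first | trivial | assumption | exact one_pos⟩
          | exact Or.inr (Or.inl ⟨by first | trivial | assumption | exact one_pos, by trivial⟩)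
          | exact Or.inr (Or.inr ⟨by trivial, by first | trivial | assumption | exact one_pos⟩))
  · exact hCR.trans_lt (neg_lt_zero.mpr hpos)
  · change IsInfinitesimal (crossRatio ((0 : F) : OnePoint F) ((1 : F) : OnePoint F)
      ((1 - ε : F) : OnePoint F) ∞ - 1)
    rw [hCR]
    exact hinf.of_abs_le 1 (by rw [abs_neg]; simp)

end Crossing

/-! ### The group of an ideal triangle -/

section IdealTriangle

open Filter Topology

/-- The sides of the ideal triangle with vertices `0, 1, ∞`. The associated group is the image of
the principal congruence subgroup of level two. -/
def idealTriangle : Fin 3 → Line ℝ :=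
  ![⟨((1 : ℝ) : OnePoint ℝ), ∞, OnePoint.coe_ne_infty _⟩,
    ⟨∞, ((0 : ℝ) : OnePoint ℝ), OnePoint.infty_ne_coe _⟩,
    ⟨((0 : ℝ) : OnePoint ℝ), ((1 : ℝ) : OnePoint ℝ), by simp⟩]

theorem isHyperbolicTriple_idealTriangle : IsHyperbolicTriple idealTriangle := by
  have h0 : ∀ w, w ∈ arc (idealTriangle 0).x (idealTriangle 0).y → ∃ r : ℝ, w = r ∧ 1 < r := by
    intro w hw
    induction w using OnePoint.rec with
    | infty => simp [arc, idealTriangle, Cyc, ltTop] at hw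
    | coe r => exact ⟨r, rfl, by simpa [arc, idealTriangle, Cyc, ltTop] using hw⟩
  have h1 : ∀ w, w ∈ arc (idealTriangle 1).x (idealTriangle 1).y → ∃ r : ℝ, w = r ∧ r < 0 := by
    intro w hw
    induction w using OnePoint.rec with
    | infty => simp [arc, idealTriangle, Cyc, ltTop] at hw
    | coe r => exact ⟨r, rfl, by simpa [arc, idealTriangle, Cyc, ltTop] using hw⟩
  have h2 : ∀ w, w ∈ arc (idealTriangle 2).x (idealTriangle 2).y →
      ∃ r : ℝ, w = r ∧ 0 < r ∧ r < 1 := by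
    intro w hw
    induction w using OnePoint.rec with
    | infty =>
      have : (1 : ℝ) < 0 := by simpa [arc, idealTriangle, Cyc, ltTop] using hw
      linarith
    | coe r =>
      refine ⟨r, rfl, ?_⟩
      change ((0 : ℝ) < r ∧ r < 1) ∨ (r < 1 ∧ (1 : ℝ) < 0) ∨ ((1 : ℝ) < 0 ∧ (0 : ℝ) < r) at hw
      rcases hw with ⟨h1, h2⟩ | ⟨h1, h2⟩ | ⟨h1, h2⟩ <;> constructor <;> linarith
  have d01 : Disjoint (arc (idealTriangle 0).x (idealTriangle 0).y)
      (arc (idealTriangle 1).x (idealTriangle 1).y) := by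
    refine Set.disjoint_left.mpr fun w hw hw' => ?_
    obtain ⟨r, rfl, hr⟩ := h0 w hw
    obtain ⟨s, hs, hs'⟩ := h1 _ hw'
    rw [OnePoint.coe_eq_coe] at hs
    linarith
  have d02 : Disjoint (arc (idealTriangle 0).x (idealTriangle 0).y)
      (arc (idealTriangle 2).x (idealTriangle 2).y) := by
    refine Set.disjoint_left.mpr fun w hw hw' => ?_
    obtain ⟨r, rfl, hr⟩ := h0 w hw
    obtain ⟨s, hs, hs'⟩ := h2 _ hw'
    rw [OnePoint.coe_eq_coe] at hs
    linarith
  have d12 : Disjoint (arc (idealTriangle 1).x (idealTriangle 1).y)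
      (arc (idealTriangle 2).x (idealTriangle 2).y) := by
    refine Set.disjoint_left.mpr fun w hw hw' => ?_
    obtain ⟨r, rfl, hr⟩ := h1 w hw
    obtain ⟨s, hs, hs'⟩ := h2 _ hw'
    rw [OnePoint.coe_eq_coe] at hs
    linarith
  intro i j hij
  fin_cases i <;> fin_cases j <;> first
    | exact absurd rfl hij
    | exact d01
    | exact d02
    | exact d12
    | exact d01.symm
    | exact d02.symm
    | exact d12.symm

theorem refl_idealTriangle_zero : (idealTriangle 0).refl = !![-1, 2; 0, 1] := by
  ext i j
  fin_cases i <;> fin_cases j <;> simp [Line.refl, idealTriangle, det2, homog_coe, homog_infty]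

theorem refl_idealTriangle_one : (idealTriangle 1).refl = !![1, 0; 0, -1] := by
  ext i j
  fin_cases i <;> fin_cases j <;> simp [Line.refl, idealTriangle, det2, homog_coe, homog_infty]

theorem refl_idealTriangle_two : (idealTriangle 2).refl = !![-1, 0; -2, 1] := by
  ext i j
  fin_cases i <;> fin_cases j <;> simp [Line.refl, idealTriangle, det2, homog_coe]

theorem isParabolicElement_mk {A : SL(2, ℝ)} (hA : A.1.trace ^ 2 = 4)
    (hne : A.1 0 1 ≠ 0 ∨ A.1 1 0 ≠ 0) : IsParabolicElement (A : PSL(2, ℝ)) := by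
  have h : (Matrix.SpecialLinearGroup.toGL A).IsParabolic := by
    refine ⟨?_, ?_⟩
    · rintro ⟨r, hr⟩
      rcases hne with h | h
      · exact h (by rw [show A.1 = Matrix.scalar (Fin 2) r from hr.symm]; simp)
      · exact h (by rw [show A.1 = Matrix.scalar (Fin 2) r from hr.symm]; simp)
    · change A.1.discr = 0
      rw [Matrix.discr_fin_two, A.2, hA]
      norm_num
  refine ⟨(Matrix.SpecialLinearGroup.toGL A).parabolicFixedPoint, h.smul_eq_self_iff.mpr rfl, ?_⟩
  intro y hy
  exact h.smul_eq_self_iff.mp hy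

theorem coe_reflMulSL_zero_one :
    ((idealTriangle 0).reflMulSL (idealTriangle 1)).1 = !![-1, -2; 0, -1] := by
  change (idealTriangle 0).refl * (idealTriangle 1).refl = _
  rw [refl_idealTriangle_zero, refl_idealTriangle_one]
  simp

theorem coe_reflMulSL_one_two :
    ((idealTriangle 1).reflMulSL (idealTriangle 2)).1 = !![-1, 0; 2, -1] := by
  change (idealTriangle 1).refl * (idealTriangle 2).refl = _
  rw [refl_idealTriangle_one, refl_idealTriangle_two]
  simp

theorem coe_reflMulSL_two_zero :
    ((idealTriangle 2).reflMulSL (idealTriangle 0)).1 = !![1, -2; 2, -3] := by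
  change (idealTriangle 2).refl * (idealTriangle 0).refl = _
  rw [refl_idealTriangle_two, refl_idealTriangle_zero]
  ext i j
  fin_cases i <;> fin_cases j <;> norm_num

theorem isParabolicElement_genA_idealTriangle :
    IsParabolicElement (genA idealTriangle : PSL(2, ℝ)) := by
  refine isParabolicElement_mk (A := (idealTriangle 0).reflMulSL (idealTriangle 1)) ?_ ?_ <;>
    rw [coe_reflMulSL_zero_one] <;> norm_num [Matrix.trace_fin_two]

theorem isParabolicElement_genB_idealTriangle :
    IsParabolicElement (genB idealTriangle : PSL(2, ℝ)) := by
  refine isParabolicElement_mk (A := (idealTriangle 1).reflMulSL (idealTriangle 2)) ?_ ?_ <;>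
    rw [coe_reflMulSL_one_two] <;> norm_num [Matrix.trace_fin_two]

theorem coe_genC (l : Fin 3 → Line ℝ) : (genC l : PSL(2, ℝ)) = (l 2).reflMul (l 0) := by
  change ((l 1).reflMul (l 2))⁻¹ * ((l 0).reflMul (l 1))⁻¹ = _
  rw [Line.reflMul_inv, Line.reflMul_inv, Line.reflMul_mul_reflMul]

theorem isParabolicElement_genC_idealTriangle :
    IsParabolicElement (genC idealTriangle : PSL(2, ℝ)) := by
  rw [coe_genC]
  refine isParabolicElement_mk (A := (idealTriangle 2).reflMulSL (idealTriangle 0)) ?_ ?_ <;>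
    rw [coe_reflMulSL_two_zero] <;> norm_num [Matrix.trace_fin_two]

/-- The point with homogeneous coordinates `[p : q]` is in the orbit of `∞` under the group of the
ideal triangle. -/
def InCuspOrbit (p q : ℤ) : Prop :=
  ∃ A : SL(2, ℝ), (A : PSL(2, ℝ)) ∈ threeHoledSphereGroup idealTriangle ∧
    A.1 0 0 * q = A.1 1 0 * p

theorem inCuspOrbit_zero (p : ℤ) : InCuspOrbit p 0 :=
  ⟨1, by rw [QuotientGroup.mk_one]; exact Subgroup.one_mem _, by simp⟩

theorem inCuspOrbit_add_iff (p q : ℤ) : InCuspOrbit (p + 2 * q) q ↔ InCuspOrbit p q := by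
  have hmem := (genA idealTriangle).2
  constructor
  · rintro ⟨A, hA, h⟩
    refine ⟨((idealTriangle 0).reflMulSL (idealTriangle 1))⁻¹ * A,
      Subgroup.mul_mem _ (Subgroup.inv_mem _ hmem) hA, ?_⟩
    rw [Matrix.SpecialLinearGroup.coe_mul, Matrix.SpecialLinearGroup.coe_inv,
      show ((idealTriangle 0).reflMulSL (idealTriangle 1)).1 = _ from coe_reflMulSL_zero_one]
    push_cast at h
    simp [Matrix.adjugate_fin_two, Matrix.mul_apply, Fin.sum_univ_two]
    linear_combination -h
  · rintro ⟨A, hA, h⟩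
    refine ⟨(idealTriangle 0).reflMulSL (idealTriangle 1) * A, Subgroup.mul_mem _ hmem hA, ?_⟩
    rw [Matrix.SpecialLinearGroup.coe_mul,
      show ((idealTriangle 0).reflMulSL (idealTriangle 1)).1 = _ from coe_reflMulSL_zero_one]
    simp [Matrix.mul_apply, Fin.sum_univ_two]
    linear_combination -h

theorem inCuspOrbit_sub_iff (p q : ℤ) : InCuspOrbit p (q - 2 * p) ↔ InCuspOrbit p q := by
  have hmem := (genB idealTriangle).2
  constructor
  · rintro ⟨A, hA, h⟩
    refine ⟨((idealTriangle 1).reflMulSL (idealTriangle 2))⁻¹ * A,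
      Subgroup.mul_mem _ (Subgroup.inv_mem _ hmem) hA, ?_⟩
    rw [Matrix.SpecialLinearGroup.coe_mul, Matrix.SpecialLinearGroup.coe_inv,
      show ((idealTriangle 1).reflMulSL (idealTriangle 2)).1 = _ from coe_reflMulSL_one_two]
    push_cast at h
    simp [Matrix.adjugate_fin_two, Matrix.mul_apply, Fin.sum_univ_two]
    linear_combination -h
  · rintro ⟨A, hA, h⟩
    refine ⟨(idealTriangle 1).reflMulSL (idealTriangle 2) * A, Subgroup.mul_mem _ hmem hA, ?_⟩
    rw [Matrix.SpecialLinearGroup.coe_mul,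
      show ((idealTriangle 1).reflMulSL (idealTriangle 2)).1 = _ from coe_reflMulSL_one_two]
    simp [Matrix.mul_apply, Fin.sum_univ_two]
    linear_combination -h

theorem iff_of_iff_add {P : ℤ → Prop} {d : ℤ} (h : ∀ p, P (p + d) ↔ P p) (p n : ℤ) :
    P (p + n * d) ↔ P p := by
  induction n with
  | zero => simp
  | succ n ih => rw [← ih, ← h (p + n * d), add_assoc, ← add_one_mul]
  | pred n ih =>
    rw [← ih, ← h (p + (-n - 1) * d), add_assoc, ← add_one_mul, sub_add_cancel]

/-- Division with a remainder of absolute value at most `|q|`, by an even multiple of `q`. -/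
theorem exists_abs_add_mul_le {q : ℤ} (hq : q ≠ 0) (p : ℤ) : ∃ n : ℤ, |p + n * (2 * q)| ≤ |q| := by
  have hpos : 0 < 2 * |q| := by positivity
  have h1 := Int.emod_add_mul_ediv (p + |q|) (2 * |q|)
  have h2 := Int.emod_nonneg (p + |q|) hpos.ne'
  have h3 := Int.emod_lt_of_pos (p + |q|) hpos
  set k := (p + |q|) / (2 * |q|)
  rcases abs_choice q with h | h
  · refine ⟨-k, ?_⟩
    rw [abs_le]
    rw [h] at h1 h2 h3 ⊢
    constructor <;> linarith
  · refine ⟨k, ?_⟩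
    rw [abs_le]
    rw [h] at h1 h2 h3 ⊢
    constructor <;> linarith

/-- The orbit of `∞` contains the fractions with odd numerator and even denominator: the
Euclidean algorithm with even quotients terminates at a zero denominator. -/
theorem inCuspOrbit_of_odd_of_even (N : ℕ) :
    ∀ p q : ℤ, Odd p → Even q → q.natAbs ≤ N → InCuspOrbit p q := by
  induction N with
  | zero =>
    intro p q _ _ hN
    rw [Int.natAbs_eq_zero.mp (Nat.le_zero.mp hN)]
    exact inCuspOrbit_zero p
  | succ N ih =>
    intro p q hp hq hN
    by_cases hq0 : q = 0
    · rw [hq0]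
      exact inCuspOrbit_zero p
    obtain ⟨n, hn⟩ := exists_abs_add_mul_le hq0 p
    rw [← iff_of_iff_add (P := fun p => InCuspOrbit p q) (fun p => inCuspOrbit_add_iff p q) p n]
    have hp' : Odd (p + n * (2 * q)) := hp.add_even ((even_two_mul q).mul_left n)
    generalize p + n * (2 * q) = p' at hn hp'
    have hp0 : p' ≠ 0 := by rintro rfl; simp at hp'
    obtain ⟨k, hk⟩ := exists_abs_add_mul_le hp0 q
    have hb : ∀ q, InCuspOrbit p' (q + 2 * p') ↔ InCuspOrbit p' q := fun q => by
      rw [← inCuspOrbit_sub_iff p' (q + 2 * p'), add_sub_cancel_right]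
    rw [← iff_of_iff_add hb q k]
    have hq' : Even (q + k * (2 * p')) := hq.add ((even_two_mul p').mul_left k)
    refine ih _ _ hp' hq' ?_
    -- an odd and an even number have different absolute values
    have hne : |p'| ≠ |q| := by
      intro h
      rw [← even_abs, ← h, even_abs] at hq
      exact Int.not_even_iff_odd.mpr hp' hq
    have := lt_of_le_of_ne hn hne
    rw [Int.abs_eq_natAbs, Int.abs_eq_natAbs] at this hk
    omega

theorem mem_limitSet_idealTriangle_of_inCuspOrbit {p q : ℤ} (h : InCuspOrbit p q) (hq : q ≠ 0) :
    (((p : ℝ) / q : ℝ) : OnePoint ℝ) ∈ limitSet (threeHoledSphereGroup idealTriangle) := by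
  obtain ⟨A, hA, h⟩ := h
  have hfix : ((genA idealTriangle : PSL(2, ℝ))) • (∞ : OnePoint ℝ) = ∞ := by
    change ((idealTriangle 0).reflMul (idealTriangle 1)) • (∞ : OnePoint ℝ) = ∞
    rw [Line.reflMul_eq_mk, mk_smul, toGL_smul_infty, coe_reflMulSL_zero_one]
    simp
  have hne : (genA idealTriangle : PSL(2, ℝ)) ≠ 1 := by
    intro h1
    obtain ⟨x, -, hx⟩ := isParabolicElement_genA_idealTriangle
    rw [h1] at hx
    have h2 := (hx ∞ (one_smul _ _)).trans (hx ((0 : ℝ) : OnePoint ℝ) (one_smul _ _)).symm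
    exact OnePoint.infty_ne_coe _ h2
  have hmem := smul_mem_limitSet (genA idealTriangle).2 hne hfix hA
  have hq' : (q : ℝ) ≠ 0 := by exact_mod_cast hq
  have hc : A.1 1 0 ≠ 0 := by
    intro hc
    rw [hc, zero_mul] at h
    have hdet := A.2
    rw [Matrix.det_fin_two, hc, (mul_eq_zero.mp h).resolve_right hq'] at hdet
    simp at hdet
  rw [mk_smul, toGL_smul_infty, if_neg hc] at hmem
  rwa [show (p : ℝ) / q = A.1 0 0 / A.1 1 0 by rw [div_eq_div_iff hq' hc]; linarith]

/-- The orbit of the cusp `∞` is dense. -/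
theorem limitSet_idealTriangle :
    limitSet (threeHoledSphereGroup idealTriangle) = Set.univ := by
  have hreal : ∀ x : ℝ, (x : OnePoint ℝ) ∈ limitSet (threeHoledSphereGroup idealTriangle) := by
    intro x
    -- approximate `x` by fractions with odd numerator and a power of two as denominator
    have happrox : Tendsto (fun k : ℕ => ((2 * ⌊2 ^ k * x⌋ + 1 : ℤ) : ℝ) / (2 ^ (k + 1) : ℤ)) atTop
        (𝓝 x) := by
      rw [tendsto_iff_norm_sub_tendsto_zero]
      refine squeeze_zero (fun _ => norm_nonneg _) (fun k => ?_)
        (tendsto_pow_atTop_nhds_zero_of_lt_one (r := (1 / 2 : ℝ)) (by norm_num) (by norm_num))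
      have h1 := Int.floor_le (2 ^ k * x)
      have h2 := Int.lt_floor_add_one (2 ^ k * x)
      have h3 : (0 : ℝ) < 2 ^ k := by positivity
      rw [Real.norm_eq_abs, abs_le, one_div, inv_pow]
      push_cast
      rw [pow_succ]
      constructor
      · rw [le_sub_iff_add_le, le_div_iff₀ (by positivity)]
        field_simp
        linarith
      · rw [sub_le_iff_le_add, div_le_iff₀ (by positivity)]
        field_simp
        linarith
    change OnePoint.map (fun t : ℝ => (t : ℂ)) (x : OnePoint ℝ) ∈ closure _
    refine isClosed_closure.mem_of_tendsto (f := fun k : ℕ =>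
      OnePoint.map (fun t : ℝ => (t : ℂ))
        ((((2 * ⌊2 ^ k * x⌋ + 1 : ℤ) : ℝ) / (2 ^ (k + 1) : ℤ) : ℝ) : OnePoint ℝ)) (b := atTop) ?_
        (Eventually.of_forall fun k => ?_)
    · exact (OnePoint.continuous_coe.tendsto _).comp
        ((Complex.continuous_ofReal.tendsto x).comp happrox)
    · refine mem_limitSet_idealTriangle_of_inCuspOrbit
        (inCuspOrbit_of_odd_of_even _ _ _ ⟨_, rfl⟩ ?_ le_rfl) (pow_ne_zero _ two_ne_zero)
      rw [pow_succ]
      exact even_two.mul_left _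
  ext x
  simp only [Set.mem_univ, iff_true]
  induction x using OnePoint.rec with
  | infty =>
    -- `∞` is the limit of the integers
    change OnePoint.map (fun t : ℝ => (t : ℂ)) (∞ : OnePoint ℝ) ∈ closure _
    refine isClosed_closure.mem_of_tendsto (f := fun k : ℕ =>
      OnePoint.map (fun t : ℝ => (t : ℂ)) ((k : ℝ) : OnePoint ℝ)) (b := atTop) ?_
      (Eventually.of_forall fun k => hreal k)
    refine OnePoint.tendsto_coe_infty.comp ?_
    rw [Filter.coclosedCompact_eq_cocompact, ← Metric.cobounded_eq_cocompact,
      ← tendsto_norm_atTop_iff_cobounded]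
    simpa using tendsto_natCast_atTop_atTop (R := ℝ)
  | coe x => exact hreal x

end IdealTriangle

end PosRep

end

open PosRep

theorem mainTheorem11 {F : Type*} [Field F] [LinearOrder F] [IsStrictOrderedRing F]
    [IsRealClosed F] :
    -- positivity criterion, over any real closed field
    (∀ l : Fin 3 → Line ℝ, IsHyperbolicTriple l →
      ∀ (ρ : threeHoledSphereGroup l →* PSL(2, F)) (p : OnePoint F) (U₁ U₂ V₁ V₂ : Set (OnePoint F)),
        IsAttractingFixedPoint (ρ (genA l)) p → p ∈ U₂ →
        [U₁, U₂, V₁, V₂].Pairwise Disjoint →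
        (∀ q, q ∉ U₁ → ρ (genA l) • q ∈ U₂) → (∀ q, q ∉ U₂ → (ρ (genA l))⁻¹ • q ∈ U₁) →
        (∀ q, q ∉ V₁ → ρ (genB l) • q ∈ V₂) → (∀ q, q ∉ V₂ → (ρ (genB l))⁻¹ • q ∈ V₁) →
        (∀ u₁ ∈ U₁, ∀ u₂ ∈ U₂, ∀ v₁ ∈ V₁, ∀ v₂ ∈ V₂, CycTuple ![u₁, u₂, v₁, v₂]) →
        IsPositive ρ) ∧
    (¬ Archimedean F →
      -- the construction, for every three-holed sphere group and every crossing triple of lines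
      (∀ l : Fin 3 → Line ℝ, IsHyperbolicTriple l → ∀ m : Fin 3 → Line F, IsCrossingTriple m →
        ∃ ρ : threeHoledSphereGroup l →* PSL(2, F),
          ρ (genA l) = (m 0).reflMul (m 1) ∧ ρ (genB l) = (m 1).reflMul (m 2) ∧
          IsInfinitesimalRotation (ρ (genC l)) ∧ (∀ q : OnePoint F, ρ (genC l) • q ≠ q) ∧
          IsPositive ρ ∧
          (IsParabolicElement (genC l : PSL(2, ℝ)) → (∀ ξ, ¬ IsFraming ρ ξ) ∧ ¬ IsFrameable ρ)) ∧
      -- crossing triples exist, and so do three-holed sphere groups of the first kind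
      (∃ m : Fin 3 → Line F, IsCrossingTriple m) ∧
      (∃ l : Fin 3 → Line ℝ, IsHyperbolicTriple l ∧ limitSet (threeHoledSphereGroup l) = Set.univ ∧
        IsParabolicElement (genA l : PSL(2, ℝ)) ∧ IsParabolicElement (genB l : PSL(2, ℝ)) ∧
        IsParabolicElement (genC l : PSL(2, ℝ)))) := by
  have hsq : ∀ x : F, 0 ≤ x → IsSquare x := by
    intro x hx
    rcases IsRealClosed.isSquare_or_isSquare_neg x with h | h
    · exact h
    · have hx0 : x = 0 := le_antisymm (neg_nonneg.mp h.nonneg) hx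
      exact ⟨0, by simp [hx0]⟩
  refine ⟨?_, fun hF => ⟨?_, exists_isCrossingTriple hF, idealTriangle,
    isHyperbolicTriple_idealTriangle, limitSet_idealTriangle, isParabolicElement_genA_idealTriangle,
    isParabolicElement_genB_idealTriangle, isParabolicElement_genC_idealTriangle⟩⟩
  · intro l hl ρ p U₁ U₂ V₁ V₂ hp hpU hdis ha ha' hb hb' hcyc
    exact isPositive_of_table hl ρ hp.smul_eq hpU hdis ha ha' hb hb' hcyc
  · intro l hl m hm
    obtain ⟨ρ, ha, hb⟩ := exists_hom_threeHoledSphereGroup hl ((m 0).reflMul (m 1))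
      ((m 1).reflMul (m 2))
    have hc : ρ (genC l) = (m 2).reflMul (m 0) := by
      rw [map_genC, ha, hb, Line.reflMul_inv, Line.reflMul_inv, Line.reflMul_mul_reflMul]
    have hrot : IsInfinitesimalRotation (ρ (genC l)) :=
      hc ▸ isInfinitesimalRotation_of_isCrossingTriple hm
    exact ⟨ρ, ha, hb, hrot, hrot.smul_ne, isPositive_of_isCrossingTriple hsq hl hm ρ ha hb,
      fun hpar => ⟨not_isFraming hpar hrot.smul_ne,
        fun ⟨ξ, hξ, _⟩ => not_isFraming hpar hrot.smul_ne ξ hξ⟩⟩
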